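/- Let $\kappa\in(0,1)$ and $\lambda=(1-\kappa^2)^{1/2}$, and write $F={}_2F_1$ for the Gauss hypergeometric function. Let $f:\mathbb R\to\mathbb R$ be the increasing bijection $$f(T)=\int_0^T F\!\left(\tfrac14,\tfrac34;\tfrac12;\kappa^2\sin^2 t\right)dt,$$ let $\phi=f^{-1}$, $\psi=\arcsin(\kappa\sin\phi)$ and $d_\kappa=\cos\psi:\mathbb R\to\mathbb R$. Let $\mathrm{dn}_2$ (the elliptic function of Shen of modulus $\kappa$) be the meromorphic function on $\mathbb C$ whose restriction to $\mathbb R$ is $d_\kappa$, and let $p_\kappa=\wp(\bullet;g_2,g_3)$ be the Weierstrass function with invariants $$g_2=\lambda^2+\tfrac13,\qquad g_3=\tfrac13\lambda^2-\tfrac1{27}.$$ Then $\mathrm{dn}_2$ and $p_\kappa$ exist, and they share a fundamental pair of periods $(2\omega_\kappa,2\omega_\kappa')$ (that is, $2\omega_\kappa,2\omega_\kappa'$ are linearly independent over $\mathbb R$ and the periods of each function are exactly the integral linear combinations of the two) such that $\omega_\kappa>0$ and $-i\,\omega_\kappa'>0$. Moreover, for every such pair, $$\sqrt{\tfrac{1+\lambda}{2}}\;\omega_\kappa=\tfrac12\pi\,F\!\left(\tfrac12,\tfrac12;1;\tfrac{1-\lambda}{1+\lambda}\right)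 \quad\text{and}\quad \sqrt{\tfrac{1+\lambda}{2}}\;\omega_\kappa'=i\,\tfrac12\pi\,F\!\left(\tfrac12,\tfrac12;1;\tfrac{2\lambda}{1+\lambda}\right).$$ -/

import Mathlib

noncomputable section

/-- The complementary modulus `λ = (1 - κ²)^{1/2}`. -/
def complementaryModulus (κ : ℝ) : ℝ := Real.sqrt (1 - κ ^ 2)

/-- `f(T) = ∫₀ᵀ F(1/4, 3/4; 1/2; κ² sin² t) dt`. -/
def shenIntegral (κ : ℝ) (T : ℝ) : ℝ :=
  ∫ t in (0 : ℝ)..T, ordinaryHypergeometric (1 / 4 : ℝ) (3 / 4) (1 / 2) (κ ^ 2 * Real.sin t ^ 2)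

/-- The inverse `φ` of the bijection `f : ℝ → ℝ`. -/
def shenPhi (κ : ℝ) : ℝ → ℝ := Function.invFun (shenIntegral κ)

/-- `ψ = arcsin (κ sin φ)`. -/
def shenPsi (κ : ℝ) (u : ℝ) : ℝ := Real.arcsin (κ * Real.sin (shenPhi κ u))

/-- The real function `d_κ = cos ψ`. -/
def shenD (κ : ℝ) (u : ℝ) : ℝ := Real.cos (shenPsi κ u)

/-- `dn` is Shen's function `dn₂` of modulus `κ`: the meromorphic function on `ℂ` whose restriction
to `ℝ` is `d_κ`. Normal form fixes the values at isolated points: removable singularities are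
filled in by continuity, and the value `0` is assigned at poles. -/
def IsShenDn (κ : ℝ) (dn : ℂ → ℂ) : Prop :=
  MeromorphicNFOn dn Set.univ ∧ ∀ u : ℝ, dn (u : ℂ) = (shenD κ u : ℂ)

/-- `p` is the Weierstrass function `℘(•; g₂, g₃)` with invariants `g₂`, `g₃`. -/
def IsWeierstrassWithInvariants (g₂ g₃ : ℂ) (p : ℂ → ℂ) : Prop :=
  ∃ L : PeriodPair, L.g₂ = g₂ ∧ L.g₃ = g₃ ∧ p = L.weierstrassP

/-- `p` is the Weierstrass function `p_κ`, of invariants `g₂ = λ² + 1/3` and `g₃ = λ²/3 - 1/27`. -/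
def IsPKappa (κ : ℝ) (p : ℂ → ℂ) : Prop :=
  IsWeierstrassWithInvariants
    ((complementaryModulus κ : ℂ) ^ 2 + 1 / 3)
    ((complementaryModulus κ : ℂ) ^ 2 / 3 - 1 / 27) p

/-- `(2ω, 2ω')` is a fundamental pair of periods of `f`: the two numbers are linearly independent
over `ℝ`, and the periods of `f` are precisely their integral linear combinations. -/
def IsFundamentalHalfPeriods (f : ℂ → ℂ) (ω ω' : ℂ) : Prop :=
  LinearIndependent ℝ ![2 * ω, 2 * ω'] ∧
    ∀ c : ℂ, Function.Periodic f c ↔ ∃ m n : ℤ, c = m * (2 * ω) + n * (2 * ω')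

/-- The normalisation `ω > 0` and `-i ω' > 0`. -/
def IsNormalizedPair (ω ω' : ℂ) : Prop :=
  (ω.im = 0 ∧ 0 < ω.re) ∧ ((-Complex.I * ω').im = 0 ∧ 0 < (-Complex.I * ω').re)

end

/-! Averaging the binomial series of $(1\mp z)^{-1/2}$ turns the integrand of $f$ into an algebraic
function of $\sin t$. Differentiating twice, $d_\kappa$ then solves $y''=-3y^2+2y+\lambda^2$ with
$y(0)=1$, $y'(0)=0$ (`hasDerivAt_shenD_aux`). For the given invariants the cubic of $\wp$ has roots
$e_1=\frac{1+\lambda}2-\frac13$, $e_2=\frac{1-\lambda}2-\frac13$, $e_3=-\frac13$. Since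
$\wp''=6\wp^2-g_2/2$ and $\wp(\omega')=e_3$, the function $\frac13-2\wp(u+\omega')$ solves the same
initial value problem, so it is $\mathrm{dn}_2$ and has the periods of $\wp$
(`dnOfWeierstrass_ofReal`).

For a rectangular lattice $\wp$ is real on both axes and has no critical points before the
half-periods. Inverting it there gives $\sqrt{e_1-e_3}\,\omega=K(m)$ and
$\sqrt{e_1-e_3}\,|\omega'|=K(1-m)$ with $m=\frac{e_2-e_3}{e_1-e_3}$ (`rectangular_roots`), and
$K(m)=\frac\pi2F(\frac12,\frac12;1;m)$.

A lattice with these invariants exists because the half-periods can be prescribed by those formulas: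
strict monotonicity of $K$ then forces the invariants (`exists_rectangular_of_invariants`). -/

section

open Filter Topology Set

/-! ### The complete elliptic integral as a hypergeometric series -/

/-- The coefficients `(1/2)ₙ / n!` of the power series of `(1 - x)^{-1/2}`. -/
noncomputable def invSqrtCoeff (n : ℕ) : ℝ := (ascPochhammer ℝ n).eval (1 / 2) / n.factorial

lemma invSqrtCoeff_zero : invSqrtCoeff 0 = 1 := by simp [invSqrtCoeff]

lemma invSqrtCoeff_succ (n : ℕ) :
    invSqrtCoeff (n + 1) = invSqrtCoeff n * ((2 * n + 1) / (2 * n + 2)) := by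
  have h : (n.factorial : ℝ) ≠ 0 := by positivity
  have h' : (n : ℝ) + 1 ≠ 0 := by positivity
  simp only [invSqrtCoeff, ascPochhammer_succ_eval, Nat.factorial_succ, Nat.cast_mul,
    Nat.cast_add, Nat.cast_one]
  field_simp
  ring

lemma invSqrtCoeff_nonneg (n : ℕ) : 0 ≤ invSqrtCoeff n := by
  induction n with
  | zero => simp [invSqrtCoeff_zero]
  | succ n ih => rw [invSqrtCoeff_succ]; positivity

lemma invSqrtCoeff_le_one (n : ℕ) : invSqrtCoeff n ≤ 1 := by
  induction n with
  | zero => simp [invSqrtCoeff_zero]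
  | succ n ih =>
    rw [invSqrtCoeff_succ]
    refine mul_le_one₀ ih (by positivity) ?_
    rw [div_le_one (by positivity)]
    linarith

lemma hasSum_invSqrtCoeff {x : ℝ} (hx : |x| < 1) :
    HasSum (fun n ↦ invSqrtCoeff n * x ^ n) (1 / Real.sqrt (1 - x)) := by
  have h := (Real.one_div_one_sub_rpow_hasFPowerSeriesOnBall_zero (1 / 2)).hasSum
    (y := x) (by simpa [enorm_eq_nnnorm] using! hx)
  rw [zero_add, ← Real.sqrt_eq_rpow] at h
  convert! h using 2 with n
  rw [FormalMultilinearSeries.ofScalars_apply_eq, smul_eq_mul, Ring.choose,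
    show (1 / 2 + (n : ℝ) - 1 - n + 1) = 1 / 2 by ring, invSqrtCoeff]
  congr 1
  rw [div_eq_iff (by positivity), mul_comm, ← nsmul_eq_mul,
    Ring.factorial_nsmul_multichoose_eq_ascPochhammer,
    Polynomial.ascPochhammer_smeval_eq_eval]

lemma integral_sin_pow_two_mul_half (n : ℕ) :
    ∫ x in (0 : ℝ)..Real.pi / 2, Real.sin x ^ (2 * n) = Real.pi / 2 * invSqrtCoeff n := by
  induction n with
  | zero => simp [invSqrtCoeff_zero]
  | succ n ih =>
    rw [mul_add, mul_one, integral_sin_pow, ih, invSqrtCoeff_succ]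
    simp
    ring

/-- The complete elliptic integral of the first kind, of parameter `m = k²`. -/
noncomputable def ellipticK (m : ℝ) : ℝ := ∫ θ in (0 : ℝ)..Real.pi / 2, 1 / Real.sqrt (1 - m * Real.sin θ ^ 2)

lemma one_sub_mul_sin_sq_pos {m : ℝ} (hm : m < 1) (θ : ℝ) : 0 < 1 - m * Real.sin θ ^ 2 := by
  rcases le_or_gt m 0 with h | h <;>
    nlinarith [Real.sin_sq_le_one θ, sq_nonneg (Real.sin θ)]

lemma continuous_ellipticK_integrand {m : ℝ} (hm : m < 1) :
    Continuous fun θ ↦ 1 / Real.sqrt (1 - m * Real.sin θ ^ 2) :=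
  continuous_const.div (by fun_prop)
    fun θ ↦ (Real.sqrt_pos.2 (one_sub_mul_sin_sq_pos hm θ)).ne'

lemma ellipticK_pos {m : ℝ} (hm : m < 1) : 0 < ellipticK m :=
  intervalIntegral.intervalIntegral_pos_of_pos
    ((continuous_ellipticK_integrand hm).intervalIntegrable _ _)
    (fun θ ↦ one_div_pos.2 (Real.sqrt_pos.2 (one_sub_mul_sin_sq_pos hm θ)))
    (by positivity)

lemma ellipticK_lt_ellipticK {m n : ℝ} (hmn : m < n) (hn : n < 1) :
    ellipticK m < ellipticK n := by
  refine intervalIntegral.integral_lt_integral_of_continuousOn_of_le_of_exists_lt (by positivity)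
    (continuous_ellipticK_integrand (hmn.trans hn)).continuousOn
    (continuous_ellipticK_integrand hn).continuousOn (fun θ _ ↦ ?_)
    ⟨Real.pi / 2, ⟨by positivity, le_rfl⟩, ?_⟩
  · refine one_div_le_one_div_of_le (Real.sqrt_pos.2 (one_sub_mul_sin_sq_pos hn θ))
      (Real.sqrt_le_sqrt ?_)
    nlinarith [sq_nonneg (Real.sin θ)]
  · refine one_div_lt_one_div_of_lt (Real.sqrt_pos.2 (one_sub_mul_sin_sq_pos hn _))
      (Real.sqrt_lt_sqrt (one_sub_mul_sin_sq_pos hn _).le ?_)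
    simp [hmn]

/-- The integrand is expanded in powers of $m\sin^2\theta$, dominated by $\sum m^n$. The coefficient
appears squared: once from the binomial series, once from the Wallis integral. -/
lemma ellipticK_eq_hypergeometric {m : ℝ} (hm₀ : 0 ≤ m) (hm : m < 1) :
    ellipticK m = Real.pi / 2 * ordinaryHypergeometric (1 / 2 : ℝ) (1 / 2) 1 m := by
  let f : ℕ → C(ℝ, ℝ) := fun n ↦
    ⟨fun θ ↦ invSqrtCoeff n * (m * Real.sin θ ^ 2) ^ n, by fun_prop⟩
  have hsum := intervalIntegral.hasSum_intervalIntegral_of_summable_norm (f := f) (a := 0)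
    (b := Real.pi / 2) (by
      refine Summable.of_nonneg_of_le (fun _ ↦ norm_nonneg _) (fun n ↦ ?_)
        (summable_geometric_of_lt_one hm₀ hm)
      rw [ContinuousMap.norm_le _ (by positivity)]
      rintro ⟨θ, -⟩
      have h1 : (m * Real.sin θ ^ 2) ^ n ≤ m ^ n :=
        pow_le_pow_left₀ (by positivity) (mul_le_of_le_one_right hm₀ (Real.sin_sq_le_one θ)) n
      have h2 : 0 ≤ (m * Real.sin θ ^ 2) ^ n := by positivity
      simp only [f, ContinuousMap.restrict_apply, ContinuousMap.coe_mk, Real.norm_eq_abs]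
      rw [abs_of_nonneg (mul_nonneg (invSqrtCoeff_nonneg n) h2)]
      nlinarith [invSqrtCoeff_nonneg n, invSqrtCoeff_le_one n])
  have h1 : ∀ θ : ℝ, ∑' n, f n θ = 1 / Real.sqrt (1 - m * Real.sin θ ^ 2) := fun θ ↦
    (hasSum_invSqrtCoeff (by
      rw [abs_of_nonneg (by positivity)]
      nlinarith [Real.sin_sq_le_one θ, sq_nonneg (Real.sin θ)])).tsum_eq
  have h2 : ∀ n, ∫ θ in (0 : ℝ)..Real.pi / 2, f n θ =
      Real.pi / 2 * (invSqrtCoeff n ^ 2 * m ^ n) := fun n ↦ by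
    simp only [f, ContinuousMap.coe_mk, mul_pow, ← pow_mul, ← mul_assoc,
      intervalIntegral.integral_const_mul, integral_sin_pow_two_mul_half]
    ring
  simp only [h1, h2] at hsum
  rw [ellipticK, ← hsum.tsum_eq, tsum_mul_left, ordinaryHypergeometric_eq_tsum]
  congr 1
  refine tsum_congr fun n ↦ ?_
  have h : (n.factorial : ℝ) ≠ 0 := by positivity
  simp only [ascPochhammer_eval_one, smul_eq_mul, invSqrtCoeff]
  field_simp

/-! ### Closed form of $F(\frac14,\frac34;\frac12;z^2)$ -/

lemma hypergeometric_quarter_coeff (n : ℕ) :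
    (n.factorial : ℝ)⁻¹ * (ascPochhammer ℝ n).eval (1 / 4) * (ascPochhammer ℝ n).eval (3 / 4) *
      ((ascPochhammer ℝ n).eval (1 / 2))⁻¹ = invSqrtCoeff (2 * n) := by
  induction n with
  | zero => simp [invSqrtCoeff_zero]
  | succ n ih =>
    rw [mul_add, mul_one, invSqrtCoeff_succ, invSqrtCoeff_succ, ← ih]
    have h0 : (ascPochhammer ℝ n).eval (1 / 2) ≠ 0 := (ascPochhammer_pos n _ (by norm_num)).ne'
    have h : (n.factorial : ℝ) ≠ 0 := by positivity
    have h' : (n : ℝ) + 1 ≠ 0 := by positivity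
    have h'' : (1 / 2 + n : ℝ) ≠ 0 := by positivity
    have h3 : (2 * (2 * n : ℝ) + 2) ≠ 0 := by positivity
    have h4 : (2 * (2 * n + 1 : ℝ) + 2) ≠ 0 := by positivity
    simp only [ascPochhammer_succ_eval, Nat.factorial_succ, Nat.cast_mul,
      Nat.cast_add, Nat.cast_one, Nat.cast_ofNat]
    field_simp
    ring

lemma hypergeometric_quarter_sq {z : ℝ} (hz : |z| < 1) :
    ordinaryHypergeometric (1 / 4 : ℝ) (3 / 4) (1 / 2) (z ^ 2) =
      (1 / Real.sqrt (1 + z) + 1 / Real.sqrt (1 - z)) / 2 := by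
  have h := ((hasSum_invSqrtCoeff (x := -z) (by rwa [abs_neg])).add
    (hasSum_invSqrtCoeff hz)).div_const 2
  rw [sub_neg_eq_add] at h
  rw [← h.tsum_eq, ordinaryHypergeometric_eq_tsum]
  have hinj : Function.Injective fun n : ℕ ↦ 2 * n := fun a b h ↦ by simpa using h
  rw [← hinj.tsum_eq]
  · refine tsum_congr fun n ↦ ?_
    rw [hypergeometric_quarter_coeff, smul_eq_mul, (even_two_mul n).neg_pow, ← pow_mul]
    ring
  · intro n hn
    rcases n.even_or_odd' with ⟨k, rfl | rfl⟩
    · exact ⟨k, rfl⟩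
    · simp [(odd_two_mul_add_one k).neg_pow] at hn

/-! ### Uniqueness for $y''=c\,y$ -/

/-- Grönwall's inequality for the pair $(h,h')$ in the sup norm. -/
lemma eq_zero_of_linear_ode_right {h h₁ c : ℝ → ℂ} {r : ℝ} (hc : ContinuousOn c (Icc 0 r))
    (hd : ∀ t ∈ Icc 0 r, HasDerivAt h (h₁ t) t)
    (hd₁ : ∀ t ∈ Icc 0 r, HasDerivAt h₁ (c t * h t) t) (h0 : h 0 = 0) (h10 : h₁ 0 = 0) :
    ∀ t ∈ Icc 0 r, h t = 0 := by
  obtain ⟨K, hK⟩ := isCompact_Icc.exists_bound_of_continuousOn hc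
  have hD : ∀ t ∈ Icc 0 r, HasDerivAt (fun t ↦ (h t, h₁ t)) (h₁ t, c t * h t) t :=
    fun t ht ↦ (hd t ht).prodMk (hd₁ t ht)
  intro t ht
  have := eq_zero_of_abs_deriv_le_mul_abs_self_of_eq_zero_right (K := max 1 K)
    (f := fun t ↦ (h t, h₁ t)) (f' := fun t ↦ (h₁ t, c t * h t)) (a := 0) (b := r)
    (fun t ht ↦ (hD t ht).continuousAt.continuousWithinAt)
    (fun t ht ↦ (hD t (Ico_subset_Icc_self ht)).hasDerivWithinAt) (by simp [h0, h10])
    (fun t ht ↦ ?_) t ht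
  · simpa using congrArg Prod.fst this
  · have hn1 : ‖h t‖ ≤ ‖(h t, h₁ t)‖ := norm_fst_le (h t, h₁ t)
    have hn2 : ‖h₁ t‖ ≤ ‖(h t, h₁ t)‖ := norm_snd_le (h t, h₁ t)
    have hn : 0 ≤ ‖(h t, h₁ t)‖ := norm_nonneg _
    refine (Prod.norm_def _).trans_le (max_le ?_ ?_)
    · exact hn2.trans (le_mul_of_one_le_left hn (le_max_left _ _))
    · dsimp only
      rw [norm_mul]
      exact mul_le_mul ((hK t (Ico_subset_Icc_self ht)).trans (le_max_right _ _)) hn1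
        (norm_nonneg _) (by positivity)

lemma eq_zero_of_linear_ode {h h₁ c : ℝ → ℂ} (hc : Continuous c)
    (hd : ∀ t, HasDerivAt h (h₁ t) t)
    (hd₁ : ∀ t, HasDerivAt h₁ (c t * h t) t) (h0 : h 0 = 0) (h10 : h₁ 0 = 0) (t : ℝ) :
    h t = 0 := by
  rcases le_total 0 t with ht | ht
  · exact eq_zero_of_linear_ode_right hc.continuousOn (fun t _ ↦ hd t) (fun t _ ↦ hd₁ t) h0 h10 t
      ⟨ht, le_rfl⟩
  · have hn : ∀ s : ℝ, HasDerivAt (fun s : ℝ ↦ -s) (-1) s := fun s ↦ hasDerivAt_neg s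
    have := eq_zero_of_linear_ode_right (h := fun s ↦ h (-s)) (h₁ := fun s ↦ -h₁ (-s))
      (c := fun s ↦ c (-s)) (r := -t) (by fun_prop)
      (fun s _ ↦ by simpa [Function.comp_def] using! (hd (-s)).scomp s (hn s))
      (fun s _ ↦ by simpa [Function.comp_def] using! ((hd₁ (-s)).scomp s (hn s)).neg) (by simpa) (by simpa) (-t)
      ⟨by linarith, le_rfl⟩
    simpa using this

/-! ### The differential equation of $d_\kappa$ -/

section shen

variable {κ : ℝ}

lemma abs_mul_sin_lt_one (hκ₀ : 0 < κ) (hκ₁ : κ < 1) (T : ℝ) : |κ * Real.sin T| < 1 := by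
  rw [abs_mul, abs_of_pos hκ₀]
  nlinarith [Real.abs_sin_le_one T, abs_nonneg (Real.sin T)]

/-- The derivative of `shenIntegral`. -/
noncomputable def shenIntegrand (κ T : ℝ) : ℝ :=
  (1 / Real.sqrt (1 + κ * Real.sin T) + 1 / Real.sqrt (1 - κ * Real.sin T)) / 2

lemma one_add_mul_sin_pos (hκ₀ : 0 < κ) (hκ₁ : κ < 1) (T : ℝ) : 0 < 1 + κ * Real.sin T := by
  linarith [(abs_lt.1 (abs_mul_sin_lt_one hκ₀ hκ₁ T)).1]

lemma one_sub_mul_sin_pos (hκ₀ : 0 < κ) (hκ₁ : κ < 1) (T : ℝ) : 0 < 1 - κ * Real.sin T := by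
  linarith [(abs_lt.1 (abs_mul_sin_lt_one hκ₀ hκ₁ T)).2]

lemma hasDerivAt_shenIntegral (hκ₀ : 0 < κ) (hκ₁ : κ < 1) (T : ℝ) :
    HasDerivAt (shenIntegral κ) (shenIntegrand κ T) T := by
  have hc : Continuous (shenIntegrand κ) := by
    refine Continuous.div_const (Continuous.add (continuous_const.div (by fun_prop) fun T ↦ ?_)
      (continuous_const.div (by fun_prop) fun T ↦ ?_)) _
    · exact (Real.sqrt_pos.2 (one_add_mul_sin_pos hκ₀ hκ₁ T)).ne'
    · exact (Real.sqrt_pos.2 (one_sub_mul_sin_pos hκ₀ hκ₁ T)).ne'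
  have h : shenIntegral κ = fun T ↦ ∫ t in (0 : ℝ)..T, shenIntegrand κ t := by
    funext T
    refine intervalIntegral.integral_congr fun t _ ↦ ?_
    simp only [← mul_pow]
    exact hypergeometric_quarter_sq (abs_mul_sin_lt_one hκ₀ hκ₁ t)
  rw [h]
  exact intervalIntegral.integral_hasDerivAt_right (hc.intervalIntegrable _ _)
    (hc.stronglyMeasurableAtFilter _ _) hc.continuousAt

/-- A crude bound from $1\pm\kappa\sin T<4$; linear growth is all that surjectivity of $f$ needs. -/
lemma one_half_le_shenIntegrand (hκ₀ : 0 < κ) (hκ₁ : κ < 1) (T : ℝ) :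
    1 / 2 ≤ shenIntegrand κ T := by
  have h1 := one_add_mul_sin_pos hκ₀ hκ₁ T
  have h2 := one_sub_mul_sin_pos hκ₀ hκ₁ T
  have hA := one_div_le_one_div_of_le (b := 2) (Real.sqrt_pos.2 h1)
    (Real.sqrt_le_iff.2 ⟨by norm_num, by linarith⟩)
  have hB := one_div_le_one_div_of_le (b := 2) (Real.sqrt_pos.2 h2)
    (Real.sqrt_le_iff.2 ⟨by norm_num, by linarith⟩)
  unfold shenIntegrand
  linarith

lemma shenIntegral_zero : shenIntegral κ 0 = 0 := by simp [shenIntegral]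

lemma monotone_shenIntegral_sub (hκ₀ : 0 < κ) (hκ₁ : κ < 1) :
    Monotone fun T ↦ shenIntegral κ T - 1 / 2 * T := by
  have hd : ∀ T, HasDerivAt (fun T ↦ shenIntegral κ T - 1 / 2 * T)
      (shenIntegrand κ T - 1 / 2 * 1) T :=
    fun T ↦ (hasDerivAt_shenIntegral hκ₀ hκ₁ T).sub ((hasDerivAt_id T).const_mul _)
  refine monotone_of_deriv_nonneg (fun T ↦ (hd T).differentiableAt) fun T ↦ ?_
  rw [(hd T).deriv]
  linarith [one_half_le_shenIntegrand hκ₀ hκ₁ T]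

lemma strictMono_shenIntegral (hκ₀ : 0 < κ) (hκ₁ : κ < 1) : StrictMono (shenIntegral κ) := by
  intro S T hST
  have := monotone_shenIntegral_sub hκ₀ hκ₁ hST.le
  dsimp only at this
  linarith

lemma continuous_shenIntegral (hκ₀ : 0 < κ) (hκ₁ : κ < 1) : Continuous (shenIntegral κ) :=
  continuous_iff_continuousAt.2 fun T ↦ (hasDerivAt_shenIntegral hκ₀ hκ₁ T).continuousAt

lemma surjective_shenIntegral (hκ₀ : 0 < κ) (hκ₁ : κ < 1) :
    Function.Surjective (shenIntegral κ) := by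
  have hm := monotone_shenIntegral_sub hκ₀ hκ₁
  refine (continuous_shenIntegral hκ₀ hκ₁).surjective ?_ ?_
  · refine Filter.tendsto_atTop_mono' _ ?_ (Filter.tendsto_id.const_mul_atTop
      (show (0 : ℝ) < 1 / 2 by norm_num))
    filter_upwards [Filter.eventually_ge_atTop 0] with T hT
    have := hm hT
    simp [shenIntegral_zero] at this
    simpa using this
  · refine Filter.tendsto_atBot_mono' _ ?_ (Filter.tendsto_id.const_mul_atBot
      (show (0 : ℝ) < 1 / 2 by norm_num))
    filter_upwards [Filter.eventually_le_atBot 0] with T hT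
    have := hm hT
    simp [shenIntegral_zero] at this
    simpa using this

lemma shenIntegral_shenPhi (hκ₀ : 0 < κ) (hκ₁ : κ < 1) (u : ℝ) :
    shenIntegral κ (shenPhi κ u) = u :=
  Function.rightInverse_invFun (surjective_shenIntegral hκ₀ hκ₁) u

lemma shenPhi_zero (hκ₀ : 0 < κ) (hκ₁ : κ < 1) : shenPhi κ 0 = 0 :=
  (strictMono_shenIntegral hκ₀ hκ₁).injective
    ((shenIntegral_shenPhi hκ₀ hκ₁ 0).trans shenIntegral_zero.symm)

lemma continuous_shenPhi (hκ₀ : 0 < κ) (hκ₁ : κ < 1) : Continuous (shenPhi κ) := by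
  let e := (strictMono_shenIntegral hκ₀ hκ₁).orderIsoOfSurjective _
    (surjective_shenIntegral hκ₀ hκ₁)
  have h : shenPhi κ = e.symm := by
    funext u
    rw [OrderIso.eq_symm_apply]
    exact shenIntegral_shenPhi hκ₀ hκ₁ u
  rw [h]
  exact e.symm.continuous

lemma hasDerivAt_shenPhi (hκ₀ : 0 < κ) (hκ₁ : κ < 1) (u : ℝ) :
    HasDerivAt (shenPhi κ) (shenIntegrand κ (shenPhi κ u))⁻¹ u :=
  HasDerivAt.of_local_left_inverse (continuous_shenPhi hκ₀ hκ₁).continuousAt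
    (hasDerivAt_shenIntegral hκ₀ hκ₁ _)
    (by linarith [one_half_le_shenIntegrand hκ₀ hκ₁ (shenPhi κ u)])
    (Filter.Eventually.of_forall (shenIntegral_shenPhi hκ₀ hκ₁))

lemma shenD_eq (hκ₀ : 0 < κ) (hκ₁ : κ < 1) (u : ℝ) :
    shenD κ u = Real.sqrt (1 + κ * Real.sin (shenPhi κ u)) *
      Real.sqrt (1 - κ * Real.sin (shenPhi κ u)) := by
  rw [← Real.sqrt_mul (one_add_mul_sin_pos hκ₀ hκ₁ _).le, shenD, shenPsi, Real.cos_arcsin]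
  congr 1
  ring

lemma shenD_zero (hκ₀ : 0 < κ) (hκ₁ : κ < 1) : shenD κ 0 = 1 := by
  simp [shenD, shenPsi, shenPhi_zero hκ₀ hκ₁]

/-- The derivative of `shenD`. -/
noncomputable def shenDDeriv (κ u : ℝ) : ℝ :=
  -(κ * Real.cos (shenPhi κ u) * (Real.sqrt (1 + κ * Real.sin (shenPhi κ u)) -
      Real.sqrt (1 - κ * Real.sin (shenPhi κ u))))

lemma shenDDeriv_zero (hκ₀ : 0 < κ) (hκ₁ : κ < 1) : shenDDeriv κ 0 = 0 := by
  simp [shenDDeriv, shenPhi_zero hκ₀ hκ₁]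

/-- With $A,B=\sqrt{1\pm\kappa\sin\varphi}$ one has $d=AB$, $A^2+B^2=2$ and $\varphi'=2AB/(A+B)$, so
every derivative is rational in $A$, $B$, $\kappa\sin\varphi$ and $\kappa\cos\varphi$. -/
lemma hasDerivAt_shenD_aux (hκ₀ : 0 < κ) (hκ₁ : κ < 1) (u : ℝ) :
    HasDerivAt (shenD κ) (shenDDeriv κ u) u ∧
      HasDerivAt (shenDDeriv κ)
        (-3 * shenD κ u ^ 2 + 2 * shenD κ u + complementaryModulus κ ^ 2) u := by
  have hpA := one_add_mul_sin_pos hκ₀ hκ₁ (shenPhi κ u)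
  have hpB := one_sub_mul_sin_pos hκ₀ hκ₁ (shenPhi κ u)
  have hφ := hasDerivAt_shenPhi hκ₀ hκ₁ u
  have hs := hφ.sin.const_mul κ
  have hA := (hs.const_add 1).sqrt hpA.ne'
  have hB := (hs.const_sub 1).sqrt hpB.ne'
  have hc := hφ.cos.const_mul κ
  have hD : shenD κ = fun u ↦ Real.sqrt (1 + κ * Real.sin (shenPhi κ u)) *
      Real.sqrt (1 - κ * Real.sin (shenPhi κ u)) := funext (shenD_eq hκ₀ hκ₁)
  have hl : complementaryModulus κ ^ 2 = 1 - κ ^ 2 := Real.sq_sqrt (by nlinarith)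
  have hsc := Real.sin_sq_add_cos_sq (shenPhi κ u)
  have hA2 := Real.sq_sqrt hpA.le
  have hB2 := Real.sq_sqrt hpB.le
  have hA0 := Real.sqrt_pos.2 hpA
  have hB0 := Real.sqrt_pos.2 hpB
  constructor
  · rw [hD]
    convert! hA.mul hB using 1
    simp only [shenDDeriv, shenIntegrand]
    set A := Real.sqrt (1 + κ * Real.sin (shenPhi κ u))
    set B := Real.sqrt (1 - κ * Real.sin (shenPhi κ u))
    field_simp
    ring
  · convert! (hc.mul (hA.sub hB)).neg using 1
    rw [hl, shenD_eq hκ₀ hκ₁]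
    simp only [shenIntegrand, Pi.sub_apply]
    set A := Real.sqrt (1 + κ * Real.sin (shenPhi κ u))
    set B := Real.sqrt (1 - κ * Real.sin (shenPhi κ u))
    set s := Real.sin (shenPhi κ u)
    set c := Real.cos (shenPhi κ u)
    have hks : κ * s = (A ^ 2 - B ^ 2) / 2 := by linarith
    have hkc : κ ^ 2 * c ^ 2 = κ ^ 2 - ((A ^ 2 - B ^ 2) / 2) ^ 2 := by
      rw [← hks]; linear_combination κ ^ 2 * hsc
    have h2 : B ^ 2 = 2 - A ^ 2 := by linarith
    have hAB : A + B ≠ 0 := by positivity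
    -- The product rule gives this form because $A'-B'$ collapses to $\kappa\cos\varphi$.
    trans (κ * s) * (A - B) * (2 * A * B / (A + B)) - κ ^ 2 * c ^ 2
    · rw [hkc, hks]
      field_simp
      grind
    · field_simp
      ring
end shen

/-! ### Differential equation, periods and critical points of $\wp$ -/

namespace PeriodPair

variable (L : PeriodPair)

lemma hasDerivAt_weierstrassP {z : ℂ} (hz : z ∉ L.lattice) :
    HasDerivAt ℘[L] (℘'[L] z) z := by
  rw [← L.deriv_weierstrassP]
  exact (L.analyticOnNhd_weierstrassP z hz).differentiableAt.hasDerivAt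

lemma countable_lattice : (L.lattice : Set ℂ).Countable :=
  Set.countable_coe_iff.1 (inferInstance : Countable L.lattice)

lemma isConnected_compl_of_countable {s : Set ℂ} (hs : s.Countable) : IsConnected sᶜ :=
  Set.Countable.isConnected_compl_of_one_lt_rank (by rw [Complex.rank_real_complex]; norm_num) hs

lemma exists_derivWeierstrassP_ne_zero : ∃ z ∉ L.lattice, ℘'[L] z ≠ 0 := by
  by_contra! h
  have h0 : ℘'[L] = 0 := by
    funext z
    by_cases hz : z ∈ L.lattice
    · exact L.derivWeierstrassP_coe ⟨z, hz⟩
    · exact h z hz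
  have ho := meromorphicOrderAt_deriv_eq_sub_one (n := -2) (Int.cast_ne_zero.2 (by norm_num))
    (by simpa using L.order_weierstrassP 0 (zero_mem _))
  rw [L.deriv_weierstrassP, h0, meromorphicOrderAt_eq_top_iff.2 (by simp)] at ho
  exact WithTop.top_ne_coe ho

/-- Differentiating the cubic relation gives $\wp'\cdot(\wp''-6\wp^2+g_2/2)=0$. On the connected
complement of the lattice one analytic factor must vanish identically, and it is not $\wp'$. -/
lemma deriv_derivWeierstrassP {z : ℂ} (hz : z ∉ L.lattice) :
    deriv ℘'[L] z = 6 * ℘[L] z ^ 2 - L.g₂ / 2 := by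
  have hA := L.analyticOnNhd_weierstrassP
  have hA' := L.analyticOnNhd_derivWeierstrassP
  have hprod : ∀ w ∈ (L.lattice : Set ℂ)ᶜ,
      ℘'[L] w * (deriv ℘'[L] w - (6 * ℘[L] w ^ 2 - L.g₂ / 2)) = 0 := by
    intro w hw
    have h1 := L.hasDerivAt_weierstrassP hw
    have h2 := (hA' w hw).differentiableAt.hasDerivAt
    have h3 : (fun z ↦ ℘'[L] z ^ 2) =ᶠ[𝓝 w]
        fun z ↦ 4 * ℘[L] z ^ 3 - L.g₂ * ℘[L] z - L.g₃ := by
      filter_upwards [L.isClosed_lattice.isOpen_compl.mem_nhds hw] with z hz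
      exact L.derivWeierstrassP_sq z hz
    have h4 := ((h2.pow 2).congr_of_eventuallyEq h3.symm).unique
      ((((h1.pow 3).const_mul 4).sub (h1.const_mul L.g₂)).sub_const L.g₃)
    simp only [Nat.cast_ofNat, Nat.reduceSub, pow_one] at h4
    linear_combination h4 / 2
  rcases AnalyticOnNhd.eq_zero_or_eq_zero_of_mul_eq_zero hA'
    (hA'.deriv.sub ((analyticOnNhd_const.mul (hA.pow 2)).sub analyticOnNhd_const)) hprod
    (isConnected_compl_of_countable L.countable_lattice).isPreconnected with h | h
  · obtain ⟨w, hw, hw'⟩ := L.exists_derivWeierstrassP_ne_zero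
    exact absurd (h w hw) hw'
  · exact sub_eq_zero.1 (h z hz)

lemma hasDerivAt_derivWeierstrassP {z : ℂ} (hz : z ∉ L.lattice) :
    HasDerivAt ℘'[L] (6 * ℘[L] z ^ 2 - L.g₂ / 2) z := by
  rw [← L.deriv_derivWeierstrassP hz]
  exact (L.analyticOnNhd_derivWeierstrassP z hz).differentiableAt.hasDerivAt

/-- For $c$ off the lattice the right side is analytic at $0$, where $\wp$ has a double pole. -/
lemma mem_lattice_of_eventuallyEq {c : ℂ} (hc : ℘[L] =ᶠ[𝓝[≠] 0] fun z ↦ ℘[L] (z + c)) :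
    c ∈ L.lattice := by
  by_contra h
  have hg : AnalyticAt ℂ (fun z ↦ ℘[L] (z + c)) 0 :=
    (L.analyticOnNhd_weierstrassP c h).comp_of_eq (by fun_prop) (zero_add c)
  have hord := L.order_weierstrassP 0 (zero_mem _)
  rw [meromorphicOrderAt_congr hc] at hord
  have := hg.meromorphicOrderAt_nonneg
  rw [hord] at this
  exact absurd this (by decide)

lemma periodic_weierstrassP_iff {c : ℂ} : Function.Periodic ℘[L] c ↔ c ∈ L.lattice :=
  ⟨fun h ↦ L.mem_lattice_of_eventuallyEq (Eventually.of_forall fun z ↦ (h z).symm),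
    fun h ↦ L.periodic_weierstrassP ⟨c, h⟩⟩

lemma eventually_add_notMem_lattice {c : ℂ} (x : ℂ) :
    ∀ᶠ z in 𝓝[≠] x, z + c ∉ L.lattice := by
  have hcont : ContinuousAt (fun z : ℂ ↦ z + c) x := by fun_prop
  filter_upwards [self_mem_nhdsWithin, nhdsWithin_le_nhds (hcont.preimage_mem_nhds
    (L.compl_lattice_sdiff_singleton_mem_nhds (x + c)))] with z h1 h2 h
  exact h2 ⟨h, fun h3 ↦ h1 (add_right_cancel h3)⟩

lemma derivWeierstrassP_eq_zero_of_two_mul_mem {z : ℂ} (hz : 2 * z ∈ L.lattice) :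
    ℘'[L] z = 0 := by
  have h := L.derivWeierstrassP_sub_coe z ⟨_, hz⟩
  rw [show z - 2 * z = -z by ring, L.derivWeierstrassP_neg] at h
  exact CharZero.neg_eq_self_iff.1 h

/-- Off the lattice, the critical points of `℘` are the half-periods. -/
lemma two_mul_mem_of_derivWeierstrassP_eq_zero {z₀ : ℂ} (hz₀ : z₀ ∉ L.lattice)
    (h0 : ℘'[L] z₀ = 0) : 2 * z₀ ∈ L.lattice := by
  obtain ⟨r, hr, hball⟩ := Metric.isOpen_iff.1 L.isClosed_lattice.isOpen_compl z₀ hz₀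
  have hmem : ∀ t ∈ Set.Icc 0 (r / 2), z₀ + (t : ℂ) ∉ L.lattice ∧ z₀ - (t : ℂ) ∉ L.lattice := by
    intro t ht
    have : ‖(t : ℂ)‖ < r := by
      rw [Complex.norm_real, Real.norm_eq_abs, abs_of_nonneg ht.1]; linarith [ht.2]
    exact ⟨hball (by simpa using this), hball (by simpa [dist_eq_norm] using this)⟩
  -- The odd part $h(t)=\wp(z_0+t)-\wp(z_0-t)$ satisfies a linear equation, with $h(0)=0$ and
  -- $h'(0)=2\wp'(z_0)=0$. So $\wp$ is symmetric about $z_0$ on a short segment.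
  have hline := eq_zero_of_linear_ode_right (r := r / 2)
    (h := fun t ↦ ℘[L] (z₀ + t) - ℘[L] (z₀ - t)) (h₁ := fun t ↦ ℘'[L] (z₀ + t) + ℘'[L] (z₀ - t))
    (c := fun t ↦ 6 * (℘[L] (z₀ + t) + ℘[L] (z₀ - t)))
    (fun t ht ↦ by
      have h1 : ContinuousAt (fun t : ℝ ↦ ℘[L] (z₀ + t)) t :=
        ContinuousAt.comp (f := fun t : ℝ ↦ z₀ + t)
          (L.hasDerivAt_weierstrassP (hmem t ht).1).continuousAt (by fun_prop)
      have h2 : ContinuousAt (fun t : ℝ ↦ ℘[L] (z₀ - t)) t :=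
        ContinuousAt.comp (f := fun t : ℝ ↦ z₀ - t)
          (L.hasDerivAt_weierstrassP (hmem t ht).2).continuousAt (by fun_prop)
      exact (continuousAt_const.mul (h1.add h2)).continuousWithinAt)
    (fun t ht ↦ by
      have h1 := ((L.hasDerivAt_weierstrassP (hmem t ht).1).comp_const_add z₀ (t : ℂ)).comp_ofReal
      have h2 := ((L.hasDerivAt_weierstrassP (hmem t ht).2).comp_const_sub z₀ (t : ℂ)).comp_ofReal
      simpa using! h1.sub h2)
    (fun t ht ↦ by
      have h1 := ((L.hasDerivAt_derivWeierstrassP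
        (hmem t ht).1).comp_const_add z₀ (t : ℂ)).comp_ofReal
      have h2 := ((L.hasDerivAt_derivWeierstrassP
        (hmem t ht).2).comp_const_sub z₀ (t : ℂ)).comp_ofReal
      convert! h1.add h2 using 1
      ring)
    (by simp) (by simp [h0])
  by_contra hnot
  set U : Set ℂ := ((L.lattice : Set ℂ) ∪ (fun z ↦ z + 2 * z₀) '' L.lattice)ᶜ with hU
  have hUconn : IsConnected U := isConnected_compl_of_countable
    (L.countable_lattice.union (L.countable_lattice.image _))
  have hUsub : ∀ z ∈ U, z ∉ L.lattice ∧ z - 2 * z₀ ∉ L.lattice := fun z hz ↦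
    ⟨fun h ↦ hz (Or.inl h), fun h ↦ hz (Or.inr ⟨_, h, by ring⟩)⟩
  have hsymm : ∀ z, ℘[L] (2 * z₀ - z) = ℘[L] (z - 2 * z₀) := fun z ↦ by
    rw [← L.weierstrassP_neg, neg_sub]
  have hz₀U : z₀ ∈ U := by
    rintro (h | ⟨w, hw, hw'⟩)
    · exact hz₀ h
    · apply hz₀
      rw [show z₀ = -w by dsimp only at hw'; linear_combination hw']
      exact neg_mem hw
  -- By evenness of $\wp$ and the identity theorem, symmetry about $z_0$ becomes invariance under
  -- translation by $2z_0$.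
  have heq : Set.EqOn ℘[L] (fun z ↦ ℘[L] (z - 2 * z₀)) U := by
    refine AnalyticOnNhd.eqOn_of_preconnected_of_frequently_eq
      (fun z hz ↦ L.analyticOnNhd_weierstrassP z (hUsub z hz).1)
      (fun z hz ↦ (L.analyticOnNhd_weierstrassP _ (hUsub z hz).2).comp_of_eq (by fun_prop) rfl)
      hUconn.isPreconnected hz₀U ?_
    have htend : Tendsto (fun t : ℝ ↦ z₀ + (t : ℂ)) (𝓝[>] 0) (𝓝[≠] z₀) := by
      refine tendsto_nhdsWithin_iff.2 ⟨?_, ?_⟩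
      · have : Continuous fun t : ℝ ↦ z₀ + (t : ℂ) := by fun_prop
        simpa using (this.tendsto 0).mono_left nhdsWithin_le_nhds
      · filter_upwards [self_mem_nhdsWithin] with t (ht : 0 < t)
        simp [ht.ne']
    refine htend.frequently (Eventually.frequently ?_)
    filter_upwards [Ioo_mem_nhdsGT (show 0 < r / 2 by positivity)] with t ht
    rw [sub_eq_zero.1 (hline t ⟨ht.1.le, ht.2.le⟩), ← hsymm]
    congr 1
    ring
  refine hnot ((neg_mem_iff (H := L.lattice)).1 (L.mem_lattice_of_eventuallyEq ?_))
  filter_upwards [L.eventually_add_notMem_lattice (c := 0) 0,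
    L.eventually_add_notMem_lattice (c := -(2 * z₀)) 0] with z h1 h2
  rw [add_zero] at h1
  rw [← sub_eq_add_neg] at h2 ⊢
  refine heq ?_
  rintro (h | ⟨w, hw, rfl⟩)
  · exact h1 h
  · exact h2 (by simpa using hw)

lemma conj_weierstrassP (hL : ∀ l ∈ L.lattice, (starRingEnd ℂ) l ∈ L.lattice) (z : ℂ) :
    (starRingEnd ℂ) (℘[L] z) = ℘[L] ((starRingEnd ℂ) z) := by
  let e : L.lattice ≃ L.lattice :=
    { toFun := fun l ↦ ⟨(starRingEnd ℂ) l, hL l l.2⟩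
      invFun := fun l ↦ ⟨(starRingEnd ℂ) l, hL l l.2⟩
      left_inv := fun l ↦ by simp
      right_inv := fun l ↦ by simp }
  rw [weierstrassP, weierstrassP, Complex.conj_tsum, ← e.tsum_eq]
  refine tsum_congr fun l ↦ ?_
  simp [e]

/-- Here $\bar z\equiv\pm z$ modulo the lattice, and $\wp$ is even and commutes with conjugation. -/
lemma weierstrassP_im_eq_zero (hL : ∀ l ∈ L.lattice, (starRingEnd ℂ) l ∈ L.lattice) {z : ℂ}
    (hz : (starRingEnd ℂ) z - z ∈ L.lattice ∨ (starRingEnd ℂ) z + z ∈ L.lattice) :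
    (℘[L] z).im = 0 := by
  rw [← Complex.conj_eq_iff_im, L.conj_weierstrassP hL]
  rcases hz with h | h
  · have := L.weierstrassP_add_coe z ⟨_, h⟩
    simpa using this
  · have := L.weierstrassP_add_coe (-z) ⟨_, h⟩
    simpa using this

end PeriodPair

/-! ### Inverting a real solution of $x'^2=4(x-e_1)(x-e_2)(x-e_3)$ -/

/-- A nowhere zero derivative has constant sign (Darboux), and the blow-up at $0^+$ rules out the
positive one. -/
lemma strictAnti_of_deriv_ne_zero_of_tendsto_atTop {x v : ℝ → ℝ} {a : ℝ} (ha : 0 < a)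
    (hx : ∀ t ∈ Ioc 0 a, HasDerivAt x (v t) t) (hv : ∀ t ∈ Ioo 0 a, v t ≠ 0)
    (h0 : Tendsto x (𝓝[>] 0) atTop) :
    (∀ t ∈ Ioo 0 a, v t < 0) ∧ (∀ t ∈ Ioo 0 a, x a < x t) ∧
      ∀ y, x a < y → ∃ t ∈ Ioo 0 a, x t = y := by
  have hc : ContinuousOn x (Ioc 0 a) := fun t ht ↦ (hx t ht).continuousAt.continuousWithinAt
  have hneg : ∀ t ∈ Ioo 0 a, v t < 0 := by
    rcases hasDerivWithinAt_forall_lt_or_forall_gt_of_forall_ne (convex_Ioo 0 a)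
      (fun t ht ↦ (hx t (Ioo_subset_Ioc_self ht)).hasDerivWithinAt) hv with h | h
    · exact h
    · exfalso
      have hm : StrictMonoOn x (Ioo 0 a) := by
        refine strictMonoOn_of_deriv_pos (convex_Ioo 0 a) (hc.mono Ioo_subset_Ioc_self) ?_
        intro t ht
        rw [interior_Ioo] at ht
        rw [(hx t (Ioo_subset_Ioc_self ht)).deriv]
        exact h t ht
      obtain ⟨t, ht, hlt⟩ := ((h0.eventually_gt_atTop (x (a / 2))).and
        (Ioo_mem_nhdsGT (show 0 < a / 2 by positivity))).exists
      exact absurd ht (hm ⟨hlt.1, by linarith [hlt.2]⟩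
        ⟨by linarith, by linarith⟩ hlt.2).not_gt
  have hanti : StrictAntiOn x (Ioc 0 a) := by
    refine strictAntiOn_of_deriv_neg (convex_Ioc 0 a) hc fun t ht ↦ ?_
    rw [interior_Ioc] at ht
    rw [(hx t (Ioo_subset_Ioc_self ht)).deriv]
    exact hneg t ht
  refine ⟨hneg, fun t ht ↦ hanti (Ioo_subset_Ioc_self ht) ⟨ha, le_rfl⟩ ht.2, fun y hy ↦ ?_⟩
  obtain ⟨t, ht, hlt⟩ := ((h0.eventually_gt_atTop y).and (Ioo_mem_nhdsGT ha)).exists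
  obtain ⟨s, hs, hsy⟩ := intermediate_value_Icc' hlt.2.le
    (hc.mono fun u hu ↦ ⟨hlt.1.trans_le hu.1, hu.2⟩) ⟨hy.le, ht.le⟩
  refine ⟨s, ⟨hlt.1.trans_le hs.1, lt_of_le_of_ne hs.2 ?_⟩, hsy⟩
  rintro rfl
  exact hy.ne hsy

/-- The substitution $\sin^2\theta=(e_1-e_3)/(x-e_3)$ brings $dx/\sqrt{\text{cubic}}$ to Legendre
form, so the incomplete integral grows at constant speed. -/
lemma hasDerivAt_ellipticK_amplitude {x : ℝ → ℝ} {v t e₁ e₂ e₃ : ℝ} (h₁₂ : e₂ < e₁)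
    (h₂₃ : e₃ < e₂) (hx : HasDerivAt x v t) (hv : v < 0) (hxe : e₁ < x t)
    (hsq : v ^ 2 = 4 * (x t - e₁) * (x t - e₂) * (x t - e₃)) :
    HasDerivAt (fun t ↦ ∫ θ in (0 : ℝ)..Real.arcsin (Real.sqrt ((e₁ - e₃) / (x t - e₃))),
      1 / Real.sqrt (1 - (e₂ - e₃) / (e₁ - e₃) * Real.sin θ ^ 2)) (Real.sqrt (e₁ - e₃)) t := by
  set m := (e₂ - e₃) / (e₁ - e₃) with hm
  have hD : 0 < e₁ - e₃ := by linarith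
  have hX : 0 < x t - e₃ := by linarith
  have hm1 : m < 1 := by rw [hm, div_lt_one hD]; linarith
  have hint := continuous_ellipticK_integrand hm1
  set q := (e₁ - e₃) / (x t - e₃) with hq
  have hq0 : 0 < q := by positivity
  have hq1 : q < 1 := by rw [hq, div_lt_one hX]; linarith
  have hmq : 0 < 1 - m * q := by
    have : 0 < m := div_pos (by linarith) hD
    nlinarith
  have hqd : HasDerivAt (fun t ↦ (e₁ - e₃) / (x t - e₃)) (-((e₁ - e₃) * v) / (x t - e₃) ^ 2) t := by
    convert! (hasDerivAt_const t (e₁ - e₃)).div (hx.sub_const e₃) hX.ne' using 1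
    simp
  have hw1 : Real.sqrt q < 1 := by rw [Real.sqrt_lt' one_pos]; simpa using hq1
  have hw0 : 0 < Real.sqrt q := Real.sqrt_pos.2 hq0
  have hθ := (Real.hasDerivAt_arcsin (x := Real.sqrt q) (by linarith) hw1.ne).comp t
    (hqd.sqrt hq0.ne')
  have hG := (intervalIntegral.integral_hasDerivAt_right
    (hint.intervalIntegrable 0 (Real.arcsin (Real.sqrt q)))
    (hint.stronglyMeasurableAtFilter _ _) hint.continuousAt).comp t hθ
  convert! hG using 1
  rw [Real.sin_arcsin (by linarith) hw1.le, Real.sq_sqrt hq0.le, ← hq]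
  have h1q : 0 < 1 - q := by linarith
  -- Both sides are nonnegative as $v<0$, so it suffices to compare squares.
  have key : -((e₁ - e₃) * v) / (x t - e₃) ^ 2 =
      2 * Real.sqrt (e₁ - e₃) * Real.sqrt q * Real.sqrt (1 - q) * Real.sqrt (1 - m * q) := by
    refine (pow_left_inj₀ (n := 2) ?_ (by positivity) two_ne_zero).1 ?_
    · exact div_nonneg (by nlinarith) (by positivity)
    · simp only [mul_pow, Real.sq_sqrt hD.le, Real.sq_sqrt hq0.le, Real.sq_sqrt h1q.le,
        Real.sq_sqrt hmq.le, div_pow, neg_sq, hsq]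
      rw [hm, hq]
      field_simp
      ring
  rw [key]
  have h1 := Real.sqrt_pos.2 h1q
  have h2 := Real.sqrt_pos.2 hmq
  field_simp

/-- The amplitude runs from $0$ at $t\to0^+$ to $\pi/2$ at $t\to a^-$. -/
lemma sqrt_mul_eq_ellipticK {x v : ℝ → ℝ} {a e₁ e₂ e₃ : ℝ} (ha : 0 < a) (h₁₂ : e₂ < e₁)
    (h₂₃ : e₃ < e₂) (hx : ∀ t ∈ Ioo 0 a, HasDerivAt x (v t) t) (hv : ∀ t ∈ Ioo 0 a, v t < 0)
    (hxe : ∀ t ∈ Ioo 0 a, e₁ < x t)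
    (hsq : ∀ t ∈ Ioo 0 a, v t ^ 2 = 4 * (x t - e₁) * (x t - e₂) * (x t - e₃))
    (h0 : Tendsto x (𝓝[>] 0) atTop) (h1 : Tendsto x (𝓝[<] a) (𝓝 e₁)) :
    Real.sqrt (e₁ - e₃) * a = ellipticK ((e₂ - e₃) / (e₁ - e₃)) := by
  have hD : 0 < e₁ - e₃ := by linarith
  have hm1 : (e₂ - e₃) / (e₁ - e₃) < 1 := by rw [div_lt_one hD]; linarith
  set G : ℝ → ℝ := fun y ↦ ∫ θ in (0 : ℝ)..y,
    1 / Real.sqrt (1 - (e₂ - e₃) / (e₁ - e₃) * Real.sin θ ^ 2) with hG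
  have hGc : Continuous G := intervalIntegral.continuous_primitive
    (fun _ _ ↦ (continuous_ellipticK_integrand hm1).intervalIntegrable _ _) 0
  set g : ℝ → ℝ := fun t ↦ G (Real.arcsin (Real.sqrt ((e₁ - e₃) / (x t - e₃)))) -
    Real.sqrt (e₁ - e₃) * t with hg
  have hgd : ∀ t ∈ Ioo 0 a, HasDerivAt g 0 t := by
    intro t ht
    convert! (hasDerivAt_ellipticK_amplitude h₁₂ h₂₃ (hx t ht) (hv t ht) (hxe t ht)
      (hsq t ht)).sub ((hasDerivAt_id t).const_mul _) using 1
    simp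
  obtain ⟨c, hc⟩ := isOpen_Ioo.exists_is_const_of_deriv_eq_zero isPreconnected_Ioo
    (fun t ht ↦ (hgd t ht).differentiableAt.differentiableWithinAt) (fun t ht ↦ (hgd t ht).deriv)
  have hF : Continuous fun q : ℝ ↦ G (Real.arcsin (Real.sqrt q)) :=
    hGc.comp (Real.continuous_arcsin.comp Real.continuous_sqrt)
  have hid : Continuous fun t : ℝ ↦ Real.sqrt (e₁ - e₃) * t := by fun_prop
  have hlim0 : Tendsto g (𝓝[>] 0) (𝓝 0) := by
    have hq : Tendsto (fun t ↦ (e₁ - e₃) / (x t - e₃)) (𝓝[>] 0) (𝓝 0) :=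
      (tendsto_atTop_add_const_right _ _ h0).const_div_atTop _
    convert! ((hF.tendsto 0).comp hq).sub ((hid.tendsto 0).mono_left nhdsWithin_le_nhds) using 2
    simp [hG]
  have hlim1 : Tendsto g (𝓝[<] a) (𝓝 (ellipticK ((e₂ - e₃) / (e₁ - e₃)) -
      Real.sqrt (e₁ - e₃) * a)) := by
    have hq : Tendsto (fun t ↦ (e₁ - e₃) / (x t - e₃)) (𝓝[<] a) (𝓝 1) := by
      have := (tendsto_const_nhds (x := e₁ - e₃)).div (h1.sub_const e₃) hD.ne'
      rwa [div_self hD.ne'] at this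
    convert! ((hF.tendsto 1).comp hq).sub ((hid.tendsto a).mono_left nhdsWithin_le_nhds) using 2
    simp [hG, ellipticK]
  have hc0 : Tendsto g (𝓝[>] 0) (𝓝 c) := tendsto_const_nhds.congr' (by
    filter_upwards [Ioo_mem_nhdsGT ha] with t ht using (hc t ht).symm)
  have hc1 : Tendsto g (𝓝[<] a) (𝓝 c) := tendsto_const_nhds.congr' (by
    filter_upwards [Ioo_mem_nhdsLT ha] with t ht using (hc t ht).symm)
  have e0 := tendsto_nhds_unique hlim0 hc0
  have e1 := tendsto_nhds_unique hlim1 hc1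
  linarith

/-! ### $\wp$ along lines on which it is real -/

namespace PeriodPair

variable (L : PeriodPair)

lemma hasDerivAt_re_weierstrassP {z₀ d : ℂ} (hreal : ∀ t : ℝ, (℘[L] (z₀ + t * d)).im = 0) {t : ℝ}
    (ht : z₀ + t * d ∉ L.lattice) :
    HasDerivAt (fun t : ℝ ↦ (℘[L] (z₀ + t * d)).re) (d * ℘'[L] (z₀ + t * d)).re t ∧
      (d * ℘'[L] (z₀ + t * d)).im = 0 := by
  have hl : HasDerivAt (fun t : ℝ ↦ z₀ + t * d) d t := by
    have := (Complex.ofRealCLM.hasDerivAt (x := t)).mul_const d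
    simpa using! this.const_add z₀
  have hf : HasDerivAt (fun t : ℝ ↦ ℘[L] (z₀ + t * d)) (d * ℘'[L] (z₀ + t * d)) t := by
    rw [mul_comm d]
    exact (L.hasDerivAt_weierstrassP ht).comp t hl
  refine ⟨(Complex.reCLM.hasFDerivAt.comp_hasDerivAt t hf), ?_⟩
  have him := Complex.imCLM.hasFDerivAt.comp_hasDerivAt t hf
  refine him.unique ?_
  have : (Complex.imCLM ∘ fun t : ℝ ↦ ℘[L] (z₀ + t * d)) = fun _ ↦ 0 := funext hreal
  rw [this]
  exact hasDerivAt_const _ _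

/-- Rolle's theorem. -/
lemma weierstrassP_re_ne_of_segment {z₀ d : ℂ} {a : ℝ} (ha : 0 < a) (hd : d ≠ 0)
    (hreal : ∀ t : ℝ, (℘[L] (z₀ + t * d)).im = 0)
    (hmem : ∀ t ∈ Icc 0 a, z₀ + t * d ∉ L.lattice)
    (hne : ∀ t ∈ Ioo 0 a, ℘'[L] (z₀ + t * d) ≠ 0) :
    (℘[L] z₀).re ≠ (℘[L] (z₀ + a * d)).re := by
  intro h
  obtain ⟨t, ht, h0⟩ := exists_hasDerivAt_eq_zero ha
    (f := fun t : ℝ ↦ (℘[L] (z₀ + t * d)).re)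
    (fun t ht ↦ (L.hasDerivAt_re_weierstrassP hreal
      (hmem t ht)).1.continuousAt.continuousWithinAt)
    (by simpa using h)
    (fun t ht ↦ (L.hasDerivAt_re_weierstrassP hreal (hmem t (Ioo_subset_Icc_self ht))).1)
  have := (L.hasDerivAt_re_weierstrassP hreal (hmem t (Ioo_subset_Icc_self ht))).2
  exact mul_ne_zero hd (hne t ht) (Complex.ext h0 this)

/-- The sign $\sigma$ treats both axes at once: $\wp(td)\sim\sigma/t^2$, which is $-1/t^2$ on the
imaginary axis. -/
lemma tendsto_re_weierstrassP_axis {d : ℂ} {σ : ℝ} (hd : d ^ 2 = σ) (hσ : σ ^ 2 = 1) :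
    Tendsto (fun t : ℝ ↦ σ * (℘[L] (t * d)).re) (𝓝[>] 0) atTop := by
  have hσ0 : σ ≠ 0 := by rintro rfl; simp at hσ
  have hEx : Tendsto (fun t : ℝ ↦ σ * (℘[L - (0 : ℂ)] (t * d)).re) (𝓝[>] 0) (𝓝 0) := by
    have h1 : ContinuousAt ℘[L - (0 : ℂ)] ((0 : ℝ) * d) := by
      rw [Complex.ofReal_zero, zero_mul]
      exact (L.analyticAt_weierstrassPExcept 0).continuousAt
    have h2 : ContinuousAt (fun t : ℝ ↦ σ * (℘[L - (0 : ℂ)] (t * d)).re) 0 :=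
      continuousAt_const.mul (Complex.continuous_re.continuousAt.comp
        (ContinuousAt.comp (f := fun t : ℝ ↦ (t : ℂ) * d) h1 (by fun_prop)))
    have h3 := h2.tendsto.mono_left (nhdsWithin_le_nhds (s := Ioi 0))
    simpa using h3
  have hsq : Tendsto (fun t : ℝ ↦ (t ^ 2)⁻¹) (𝓝[>] 0) atTop := by
    have := (tendsto_pow_atTop (two_ne_zero)).comp (tendsto_inv_nhdsGT_zero (𝕜 := ℝ))
    simpa [Function.comp_def] using this
  refine (hEx.add_atTop hsq).congr' ?_
  filter_upwards [self_mem_nhdsWithin] with t (ht : 0 < t)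
  have h := L.weierstrassPExcept_add 0 (t * d)
  simp only [ZeroMemClass.coe_zero, sub_zero] at h
  -- At the lattice point $0$ the correction term `1 / 0 ^ 2` is $0$ by convention.
  have h2 : (1 / ((t : ℂ) * d) ^ 2 - 1 / 0 ^ 2) = ((σ * (t ^ 2)⁻¹ : ℝ) : ℂ) := by
    rw [mul_pow, hd]
    have : (σ : ℂ) ≠ 0 := by exact_mod_cast hσ0
    have h' : (t : ℂ) ≠ 0 := by exact_mod_cast ht.ne'
    have h3 : (σ : ℂ) ^ 2 = 1 := by exact_mod_cast hσ
    push_cast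
    field_simp
    simp [h3]
  rw [← h, h2, Complex.add_re, Complex.ofReal_re]
  linear_combination (-(t ^ 2)⁻¹) * hσ

/-- The behaviour of `℘` on a half-axis `(0, a] • d` on which it is real and has no critical point
before `a`; here `d² = σ = ±1`. -/
lemma axis {d : ℂ} {σ a : ℝ} (ha : 0 < a) (hd : d ^ 2 = σ) (hσ : σ ^ 2 = 1)
    (hreal : ∀ t : ℝ, (℘[L] (t * d)).im = 0)
    (hmem : ∀ t ∈ Ioc 0 a, t * d ∉ L.lattice)
    (hne : ∀ t ∈ Ioo 0 a, ℘'[L] (t * d) ≠ 0) :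
    (∀ y, σ * (℘[L] (a * d)).re < y → ∃ t ∈ Ioo 0 a, σ * (℘[L] (t * d)).re = y) ∧
    ∀ e₁ e₂ e₃ : ℝ, e₂ < e₁ → e₃ < e₂ → σ * (℘[L] (a * d)).re = e₁ →
      (∀ z ∉ L.lattice, ℘'[L] z ^ 2 =
        4 * (℘[L] z - σ * e₁) * (℘[L] z - σ * e₂) * (℘[L] z - σ * e₃)) →
      Real.sqrt (e₁ - e₃) * a = ellipticK ((e₂ - e₃) / (e₁ - e₃)) := by
  have hσ0 : σ ≠ 0 := by rintro rfl; simp at hσ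
  have hd0 : d ≠ 0 := by
    rintro rfl
    apply hσ0
    have : ((σ : ℝ) : ℂ) = 0 := by rw [← hd]; simp
    exact_mod_cast this
  have hreal' : ∀ t : ℝ, (℘[L] (0 + t * d)).im = 0 := by simpa using hreal
  have hx : ∀ t ∈ Ioc 0 a, HasDerivAt (fun t : ℝ ↦ σ * (℘[L] (t * d)).re)
      (σ * (d * ℘'[L] (t * d)).re) t ∧ (d * ℘'[L] (t * d)).im = 0 := fun t ht ↦ by
    have := L.hasDerivAt_re_weierstrassP hreal' (t := t) (by simpa using hmem t ht)
    simp only [zero_add] at this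
    exact ⟨this.1.const_mul σ, this.2⟩
  have h0 := L.tendsto_re_weierstrassP_axis hd hσ
  obtain ⟨h1, h2, h3⟩ := strictAnti_of_deriv_ne_zero_of_tendsto_atTop ha (fun t ht ↦ (hx t ht).1)
    (fun t ht ↦ mul_ne_zero hσ0 fun h ↦ mul_ne_zero hd0 (hne t ht)
      (Complex.ext h (hx t (Ioo_subset_Ioc_self ht)).2)) h0
  refine ⟨h3, fun e₁ e₂ e₃ h₁₂ h₂₃ he hcub ↦ ?_⟩
  refine sqrt_mul_eq_ellipticK ha h₁₂ h₂₃ (fun t ht ↦ (hx t (Ioo_subset_Ioc_self ht)).1) h1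
    (fun t ht ↦ he ▸ h2 t ht) (fun t ht ↦ ?_) h0 ?_
  · have ht' := Ioo_subset_Ioc_self ht
    have hP : ℘[L] (t * d) = ((℘[L] (t * d)).re : ℂ) := Complex.ext rfl (hreal t)
    have hP' : d * ℘'[L] (t * d) = ((d * ℘'[L] (t * d)).re : ℂ) := Complex.ext rfl (hx t ht').2
    have hc := hcub _ (hmem t ht')
    have hσ' : (σ : ℂ) ^ 2 = 1 := by exact_mod_cast hσ
    rw [← Complex.ofReal_inj]
    push_cast
    rw [← hP, ← hP', mul_pow, mul_pow, hd, hc]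
    set P := ℘[L] (t * d)
    have hs3 : (σ : ℂ) ^ 3 = σ := by rw [pow_succ, hσ', one_mul]
    -- As $\sigma^2=1$, factoring $\sigma$ out of each bracket shows that $\sigma\wp$ obeys the
    -- equation with roots $e_i$.
    have hs1 : ∀ e : ℂ, P - σ * e = σ * (σ * P - e) := fun e ↦ by linear_combination (-P) * hσ'
    rw [hs1, hs1, hs1]
    linear_combination (4 * (σ * P - e₁) * (σ * P - e₂) * (σ * P - e₃)) *
      ((σ : ℂ) ^ 4 + σ ^ 2 + 1) * hσ'
  · rw [← he]
    exact (hx a ⟨ha, le_rfl⟩).1.continuousAt.tendsto.mono_left nhdsWithin_le_nhds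

end PeriodPair

/-! ### Rectangular lattices -/

namespace PeriodPair

/-- The pair of periods `2a`, `2bi` spanning a rectangular lattice. -/
noncomputable def rectangular (a b : ℝ) (ha : 0 < a) (hb : 0 < b) : PeriodPair where
  ω₁ := 2 * (a : ℂ)
  ω₂ := 2 * (b * Complex.I)
  indep := by
    rw [LinearIndependent.pair_iff]
    intro s t h
    have hre := congrArg Complex.re h
    have him := congrArg Complex.im h
    simp at hre him
    exact ⟨hre.resolve_right ha.ne', him.resolve_right hb.ne'⟩

variable {a b : ℝ} {ha : 0 < a} {hb : 0 < b}

lemma mem_lattice_rectangular {z : ℂ} : z ∈ (rectangular a b ha hb).lattice ↔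
    ∃ m n : ℤ, z.re = m * (2 * a) ∧ z.im = n * (2 * b) := by
  rw [mem_lattice]
  refine exists_congr fun m ↦ exists_congr fun n ↦ ?_
  rw [Complex.ext_iff]
  simp [rectangular, eq_comm]

lemma ne_int_mul_two_mul {t c : ℝ} (h0 : 0 < t) (h1 : t < 2 * c) (m : ℤ) : t ≠ m * (2 * c) := by
  rintro rfl
  have hc : 0 < 2 * c := h0.trans h1
  have hm0 : (0 : ℝ) < m := by
    by_contra! h
    nlinarith
  have hm1 : (m : ℝ) < 1 := by
    by_contra! h
    nlinarith
  norm_cast at hm0 hm1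
  omega

lemma notMem_rectangular_of_re {z : ℂ} (h0 : 0 < z.re) (h1 : z.re < 2 * a) :
    z ∉ (rectangular a b ha hb).lattice := by
  rw [mem_lattice_rectangular]
  rintro ⟨m, n, h, -⟩
  exact ne_int_mul_two_mul h0 h1 m h

lemma notMem_rectangular_of_im {z : ℂ} (h0 : 0 < z.im) (h1 : z.im < 2 * b) :
    z ∉ (rectangular a b ha hb).lattice := by
  rw [mem_lattice_rectangular]
  rintro ⟨m, n, -, h⟩
  exact ne_int_mul_two_mul h0 h1 n h

lemma conj_mem_rectangular (l : ℂ) (hl : l ∈ (rectangular a b ha hb).lattice) :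
    (starRingEnd ℂ) l ∈ (rectangular a b ha hb).lattice := by
  rw [mem_lattice_rectangular] at *
  obtain ⟨m, n, h1, h2⟩ := hl
  exact ⟨m, -n, by simpa using h1, by simp [h2]⟩

lemma weierstrassP_rectangular_im_of_im {z : ℂ} (n : ℤ) (hz : z.im = n * b) :
    (℘[rectangular a b ha hb] z).im = 0 := by
  refine weierstrassP_im_eq_zero _ conj_mem_rectangular (Or.inl ?_)
  rw [mem_lattice_rectangular]
  refine ⟨0, -n, by simp, ?_⟩
  simp [hz]
  ring

lemma weierstrassP_rectangular_im_of_re {z : ℂ} (n : ℤ) (hz : z.re = n * a) :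
    (℘[rectangular a b ha hb] z).im = 0 := by
  refine weierstrassP_im_eq_zero _ conj_mem_rectangular (Or.inr ?_)
  rw [mem_lattice_rectangular]
  refine ⟨n, 0, ?_, by simp⟩
  simp [hz]
  ring

lemma derivWeierstrassP_rectangular_ne_zero {z : ℂ} (hz : z ∉ (rectangular a b ha hb).lattice)
    (h : (0 < z.re ∧ z.re < a) ∨ (0 < z.im ∧ z.im < b)) :
    ℘'[rectangular a b ha hb] z ≠ 0 := by
  intro h0
  have := two_mul_mem_of_derivWeierstrassP_eq_zero _ hz h0
  rcases h with h | h
  · exact notMem_rectangular_of_re (by simpa using h.1) (by simpa using h.2) this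
  · exact notMem_rectangular_of_im (by simpa using h.1) (by simpa using h.2) this

lemma cubic_eq_zero_of_two_mul_mem (L : PeriodPair) {z : ℂ} (hz : z ∉ L.lattice)
    (h2z : 2 * z ∈ L.lattice) : 4 * ℘[L] z ^ 3 - L.g₂ * ℘[L] z - L.g₃ = 0 := by
  rw [← L.derivWeierstrassP_sq z hz, L.derivWeierstrassP_eq_zero_of_two_mul_mem h2z]
  simp

/-- The roots of the cubic of a rectangular lattice are real, and the half-periods are given by
complete elliptic integrals. -/
theorem rectangular_roots (a b : ℝ) (ha : 0 < a) (hb : 0 < b) :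
    ∃ e₁ e₂ e₃ : ℝ, e₂ < e₁ ∧ e₃ < e₂ ∧ e₁ + e₂ + e₃ = 0 ∧
      (rectangular a b ha hb).g₂ = ((-4 * (e₁ * e₂ + e₁ * e₃ + e₂ * e₃) : ℝ) : ℂ) ∧
      (rectangular a b ha hb).g₃ = ((4 * (e₁ * e₂ * e₃) : ℝ) : ℂ) ∧
      ℘[rectangular a b ha hb] (b * Complex.I) = e₃ ∧
      Real.sqrt (e₁ - e₃) * a = ellipticK ((e₂ - e₃) / (e₁ - e₃)) ∧
      Real.sqrt (e₁ - e₃) * b = ellipticK ((e₁ - e₂) / (e₁ - e₃)) := by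
  set L := rectangular a b ha hb
  have ha2 : a < 2 * a := by linarith
  have hb2 : b < 2 * b := by linarith
  have hm1 : (a : ℂ) ∉ L.lattice := notMem_rectangular_of_re (by simpa) (by simpa)
  have hm2 : (a + b * Complex.I : ℂ) ∉ L.lattice :=
    notMem_rectangular_of_re (by simpa) (by simpa)
  have hm3 : (b * Complex.I : ℂ) ∉ L.lattice := notMem_rectangular_of_im (by simpa) (by simpa)
  have hh1 : 2 * (a : ℂ) ∈ L.lattice := L.ω₁_mem_lattice
  have hh3 : 2 * (b * Complex.I : ℂ) ∈ L.lattice := L.ω₂_mem_lattice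
  have hh2 : 2 * (a + b * Complex.I : ℂ) ∈ L.lattice := by
    rw [mul_add]; exact add_mem hh1 hh3
  set e₁ := (℘[L] a).re with he₁
  set e₂ := (℘[L] (a + b * Complex.I)).re with he₂
  set e₃ := (℘[L] (b * Complex.I)).re with he₃
  have hP1 : ℘[L] a = e₁ := Complex.ext rfl (weierstrassP_rectangular_im_of_im 0 (by simp))
  have hP2 : ℘[L] (a + b * Complex.I) = e₂ :=
    Complex.ext rfl (weierstrassP_rectangular_im_of_im 1 (by simp))
  have hP3 : ℘[L] (b * Complex.I) = e₃ :=
    Complex.ext rfl (weierstrassP_rectangular_im_of_im 1 (by simp))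
  have hc1 := L.cubic_eq_zero_of_two_mul_mem hm1 hh1
  have hc2 := L.cubic_eq_zero_of_two_mul_mem hm2 hh2
  have hc3 := L.cubic_eq_zero_of_two_mul_mem hm3 hh3
  rw [hP1] at hc1
  rw [hP2] at hc2
  rw [hP3] at hc3
  -- $e_1,e_2$ are the values at the ends of the vertical side from $a$ to $a+bi$, which has no
  -- interior critical point.
  have hne12 : e₁ ≠ e₂ := by
    refine L.weierstrassP_re_ne_of_segment hb Complex.I_ne_zero
      (fun t ↦ weierstrassP_rectangular_im_of_re 1 (by simp))
      (fun t _ ↦ notMem_rectangular_of_re (by simpa) (by simpa)) (fun t ht ↦ ?_)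
    exact derivWeierstrassP_rectangular_ne_zero
      (notMem_rectangular_of_re (by simpa) (by simpa)) (Or.inr (by simpa using ht))
  have hne32 : e₃ ≠ e₂ := by
    rw [he₂, add_comm, ← mul_one (a : ℂ)]
    refine L.weierstrassP_re_ne_of_segment ha one_ne_zero
      (fun t ↦ weierstrassP_rectangular_im_of_im 1 (by simp))
      (fun t _ ↦ notMem_rectangular_of_im (by simpa) (by simpa)) (fun t ht ↦ ?_)
    exact derivWeierstrassP_rectangular_ne_zero
      (notMem_rectangular_of_im (by simpa) (by simpa)) (Or.inl (by simpa using ht))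
  have hnA : ∀ t ∈ Ioc 0 a, (t : ℂ) * 1 ∉ L.lattice := fun t ht ↦
    notMem_rectangular_of_re (by simpa using ht.1) (by simp; linarith [ht.2])
  have hdA : ∀ t ∈ Ioo 0 a, ℘'[L] (t * 1) ≠ 0 := fun t ht ↦
    derivWeierstrassP_rectangular_ne_zero (hnA t (Ioo_subset_Ioc_self ht))
      (Or.inl (by simpa using ht))
  have hnB : ∀ t ∈ Ioc 0 b, (t : ℂ) * Complex.I ∉ L.lattice := fun t ht ↦
    notMem_rectangular_of_im (by simpa using ht.1) (by simp; linarith [ht.2])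
  have hdB : ∀ t ∈ Ioo 0 b, ℘'[L] (t * Complex.I) ≠ 0 := fun t ht ↦
    derivWeierstrassP_rectangular_ne_zero (hnB t (Ioo_subset_Ioc_self ht))
      (Or.inr (by simpa using ht))
  have hrA : ∀ t : ℝ, (℘[L] (t * 1)).im = 0 :=
    fun t ↦ weierstrassP_rectangular_im_of_im 0 (by simp)
  have hrB : ∀ t : ℝ, (℘[L] (t * Complex.I)).im = 0 :=
    fun t ↦ weierstrassP_rectangular_im_of_re 0 (by simp)
  obtain ⟨hsA, hKA⟩ := L.axis (d := 1) (σ := 1) ha (by simp) (by norm_num) hrA hnA hdA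
  obtain ⟨hsB, hKB⟩ := L.axis (d := Complex.I) (σ := -1) hb (by simp) (by norm_num) hrB hnB hdB
  -- Otherwise $\wp$ would take the value $e_2$ inside $(0,a)$; the cubic vanishes there, which
  -- makes the point critical.
  have h21 : e₂ < e₁ := by
    refine lt_of_le_of_ne (not_lt.1 fun h ↦ ?_) hne12.symm
    obtain ⟨t, ht, hte⟩ := hsA e₂ (by simpa using h)
    apply hdA t ht
    have : ℘[L] (t * 1) = e₂ := Complex.ext (by simpa using hte) (hrA t)
    rw [← sq_eq_zero_iff, L.derivWeierstrassP_sq _ (hnA t (Ioo_subset_Ioc_self ht)), this, hc2]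
  have h32 : e₃ < e₂ := by
    refine lt_of_le_of_ne (not_lt.1 fun h ↦ ?_) hne32
    obtain ⟨t, ht, hte⟩ := hsB (-e₂) (by simpa using h)
    apply hdB t ht
    have : ℘[L] (t * Complex.I) = e₂ := Complex.ext (by simpa using hte) (hrB t)
    rw [← sq_eq_zero_iff, L.derivWeierstrassP_sq _ (hnB t (Ioo_subset_Ioc_self ht)), this, hc2]
  have d12 : (e₁ - e₂ : ℂ) ≠ 0 := sub_ne_zero.2 (by exact_mod_cast h21.ne')
  have d32 : (e₃ - e₂ : ℂ) ≠ 0 := sub_ne_zero.2 (by exact_mod_cast h32.ne)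
  have d13 : (e₁ - e₃ : ℂ) ≠ 0 := sub_ne_zero.2 (by exact_mod_cast (h32.trans h21).ne')
  -- Vieta's formulas, by dividing differences of the cubic equations by the nonzero root
  -- differences.
  have hg12 : L.g₂ = 4 * (e₁ ^ 2 + e₁ * e₂ + e₂ ^ 2) :=
    mul_left_cancel₀ d12 (by linear_combination hc2 - hc1)
  have hg32 : L.g₂ = 4 * (e₃ ^ 2 + e₃ * e₂ + e₂ ^ 2) :=
    mul_left_cancel₀ d32 (by linear_combination hc2 - hc3)
  have hsum : (e₁ + e₂ + e₃ : ℂ) = 0 :=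
    mul_left_cancel₀ d13 (by linear_combination (hg32 - hg12) / 4)
  have hg2 : L.g₂ = ((-4 * (e₁ * e₂ + e₁ * e₃ + e₂ * e₃) : ℝ) : ℂ) := by
    push_cast
    linear_combination hg12 + 4 * (e₁ + e₂) * hsum
  have hg3 : L.g₃ = ((4 * (e₁ * e₂ * e₃) : ℝ) : ℂ) := by
    push_cast at hg2 ⊢
    linear_combination -hc1 - e₁ * hg2 + 4 * e₁ ^ 2 * hsum
  have hcub : ∀ z ∉ L.lattice, ℘'[L] z ^ 2 =
      4 * (℘[L] z - e₁) * (℘[L] z - e₂) * (℘[L] z - e₃) := fun z hz ↦ by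
    rw [L.derivWeierstrassP_sq z hz, hg2, hg3]
    push_cast
    linear_combination 4 * ℘[L] z ^ 2 * hsum
  refine ⟨e₁, e₂, e₃, h21, h32, by exact_mod_cast hsum, hg2, hg3, hP3, ?_, ?_⟩
  · refine hKA e₁ e₂ e₃ h21 h32 (by simp [he₁]) fun z hz ↦ ?_
    rw [hcub z hz]
    simp
  -- On the imaginary axis $-\wp$ has roots $-e_3>-e_2>-e_1$, whence the complementary parameter.
  · have := hKB (-e₃) (-e₂) (-e₁) (by linarith) (by linarith) (by simp [he₃]) fun z hz ↦ ?_
    · rwa [show -e₃ - -e₁ = e₁ - e₃ by ring, show -e₂ - -e₁ = e₁ - e₂ by ring] at this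
    · rw [hcub z hz]
      push_cast
      ring

end PeriodPair

/-! ### The meromorphic function $\mathrm{dn}_2$ -/

/-- Infinite order of $f-g$ at $0$ spreads to all of $\mathbb C$; normal form upgrades agreement on
punctured neighbourhoods to equality. -/
lemma eq_of_meromorphicNFOn_of_eq_ofReal {f g : ℂ → ℂ} (hf : MeromorphicNFOn f univ)
    (hg : MeromorphicNFOn g univ) (h : ∀ u : ℝ, f u = g u) : f = g := by
  have hmf : Meromorphic f := fun z ↦ (hf (mem_univ z)).meromorphicAt
  have hmg : Meromorphic g := fun z ↦ (hg (mem_univ z)).meromorphicAt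
  have htend : Tendsto (fun t : ℝ ↦ (t : ℂ)) (𝓝[>] 0) (𝓝[≠] 0) := by
    refine tendsto_nhdsWithin_iff.2 ⟨?_, ?_⟩
    · simpa using (Complex.continuous_ofReal.tendsto 0).mono_left nhdsWithin_le_nhds
    · filter_upwards [self_mem_nhdsWithin] with t (ht : 0 < t)
      simpa using ht.ne'
  have h0 : f =ᶠ[𝓝[≠] 0] g := (MeromorphicAt.frequently_eq_iff_eventuallyEq (hmf 0) (hmg 0)).1
    (htend.frequently (Eventually.frequently (Eventually.of_forall h)))
  have hall : ∀ z, meromorphicOrderAt (f - g) z = ⊤ := by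
    by_contra! hne
    refine (hmf.sub hmg).exists_meromorphicOrderAt_ne_top_iff_forall.1 hne 0 ?_
    rw [meromorphicOrderAt_eq_top_iff]
    filter_upwards [h0] with z hz
    simp [hz]
  funext z
  refine (((hf (mem_univ z)).eventuallyEq_nhdsNE_iff_eventuallyEq_nhds
    (hg (mem_univ z))).1 ?_).eq_of_nhds
  filter_upwards [meromorphicOrderAt_eq_top_iff.1 (hall z)] with y hy
  exact sub_eq_zero.1 hy

namespace PeriodPair

variable (L : PeriodPair)

open Classical in
/-- The elliptic function `1/3 - 2 ℘(z + w)`, with the value `0` at its poles. -/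
noncomputable def dnOfWeierstrass (w z : ℂ) : ℂ :=
  if z + w ∈ L.lattice then 0 else 1 / 3 - 2 * ℘[L] (z + w)

lemma dnOfWeierstrass_of_notMem {w z : ℂ} (h : z + w ∉ L.lattice) :
    L.dnOfWeierstrass w z = 1 / 3 - 2 * ℘[L] (z + w) := if_neg h

lemma meromorphicNFOn_dnOfWeierstrass (w : ℂ) : MeromorphicNFOn (L.dnOfWeierstrass w) univ := by
  intro x _
  have hsh : ∀ f : ℂ → ℂ, AnalyticAt ℂ f (x + w) → AnalyticAt ℂ (fun z ↦ f (z + w)) x :=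
    fun f hf ↦ hf.comp_of_eq (g := f) (f := fun z ↦ z + w) (by fun_prop) rfl
  by_cases hx : x + w ∈ L.lattice
  · obtain ⟨g, hg, hg0, hgP⟩ := (meromorphicOrderAt_eq_int_iff (n := -2)
      (L.meromorphic_weierstrassP (x + w))).1 (by simpa using L.order_weierstrassP _ hx)
    refine Or.inr ⟨-2, fun z ↦ 1 / 3 * (z - x) ^ 2 - 2 * g (z + w), ?_, by simpa using hg0, ?_⟩
    · have := hsh g hg
      fun_prop
    · have hcont : ContinuousAt (fun z : ℂ ↦ z + w) x := by fun_prop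
      have hP := hcont.eventually (eventually_nhdsWithin_iff.1 hgP)
      filter_upwards [eventually_nhdsWithin_iff.1 (L.eventually_add_notMem_lattice (c := w) x),
        hP] with z h1 h2
      rcases eq_or_ne z x with rfl | hz
      -- At the pole itself `0 ^ (-2)` is $0$, matching the assigned value.
      · simp [dnOfWeierstrass, hx]
      · have hz' : z - x ≠ 0 := sub_ne_zero.2 hz
        have h3 := h2 (by simpa using hz)
        rw [L.dnOfWeierstrass_of_notMem (h1 hz), h3]
        simp only [add_sub_add_right_eq_sub, smul_eq_mul, Pi.smul_apply', Pi.pow_apply]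
        rw [show (-2 : ℤ) = -((2 : ℕ) : ℤ) from rfl, zpow_neg, zpow_natCast]
        field_simp
  · refine AnalyticAt.meromorphicNFAt ?_
    have hcont : ContinuousAt (fun z : ℂ ↦ z + w) x := by fun_prop
    have hA := hsh _ (L.analyticOnNhd_weierstrassP _ hx)
    refine (analyticAt_const.sub (analyticAt_const.mul hA) :
      AnalyticAt ℂ (fun z ↦ 1 / 3 - 2 * ℘[L] (z + w)) x).congr ?_
    filter_upwards [hcont.preimage_mem_nhds (L.isClosed_lattice.isOpen_compl.mem_nhds hx)]
      with z hz using (L.dnOfWeierstrass_of_notMem hz).symm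

lemma periodic_dnOfWeierstrass_iff (w : ℂ) {c : ℂ} :
    Function.Periodic (L.dnOfWeierstrass w) c ↔ c ∈ L.lattice := by
  constructor
  · refine fun h ↦ L.mem_lattice_of_eventuallyEq ?_
    filter_upwards [L.eventually_add_notMem_lattice (c := 0) 0,
      L.eventually_add_notMem_lattice (c := c) 0] with z h1 h2
    rw [add_zero] at h1
    have h3 := h (z - w)
    have e1 : z - w + w = z := by ring
    have e2 : z - w + c + w = z + c := by ring
    rw [L.dnOfWeierstrass_of_notMem (by rwa [e2]), L.dnOfWeierstrass_of_notMem (by rwa [e1]),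
      e1, e2] at h3
    linear_combination h3 / 2
  · intro h z
    have hmem : z + w + c ∈ L.lattice ↔ z + w ∈ L.lattice := L.lattice.add_mem_iff_left h
    rw [dnOfWeierstrass, add_right_comm, L.periodic_weierstrassP_iff.2 h]
    by_cases hz : z + w ∈ L.lattice
    · rw [if_pos (hmem.2 hz), dnOfWeierstrass, if_pos hz]
    · rw [if_neg (hz ∘ hmem.1), dnOfWeierstrass, if_neg hz]

/-- Lets the invariants pass between two bases of one lattice. -/
lemma G_congr {L L' : PeriodPair} (h : L.lattice = L'.lattice) (n : ℕ) : L.G n = L'.G n := by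
  unfold G
  rw [h]

/-! ### From invariants to half-periods, and existence of the lattice -/

/-- Both triples are roots of one cubic, and the ordering leaves a single matching. -/
lemma roots_of_invariants {l e₁ e₂ e₃ : ℝ} (hl₀ : 0 < l) (hl₁ : l < 1)
    (h₁₂ : e₂ < e₁) (h₂₃ : e₃ < e₂) (hsum : e₁ + e₂ + e₃ = 0)
    (h2 : -4 * (e₁ * e₂ + e₁ * e₃ + e₂ * e₃) = l ^ 2 + 1 / 3)
    (h3 : 4 * (e₁ * e₂ * e₃) = l ^ 2 / 3 - 1 / 27) :
    e₁ = (1 + l) / 2 - 1 / 3 ∧ e₂ = (1 - l) / 2 - 1 / 3 ∧ e₃ = -1 / 3 := by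
  have key : ∀ e, (e - e₁) * (e - e₂) * (e - e₃) = 0 →
      e = (1 + l) / 2 - 1 / 3 ∨ e = (1 - l) / 2 - 1 / 3 ∨ e = -1 / 3 := by
    intro e he
    have : (e - ((1 + l) / 2 - 1 / 3)) * ((e - ((1 - l) / 2 - 1 / 3)) * (e - -1 / 3)) = 0 := by
      linear_combination he + e ^ 2 * hsum + e / 4 * h2 + h3 / 4
    rcases mul_eq_zero.1 this with h | h
    · exact Or.inl (sub_eq_zero.1 h)
    · rcases mul_eq_zero.1 h with h | h
      · exact Or.inr (Or.inl (sub_eq_zero.1 h))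
      · exact Or.inr (Or.inr (sub_eq_zero.1 h))
  rcases key e₁ (by ring) with h1 | h1 | h1 <;> rcases key e₂ (by ring) with h2 | h2 | h2 <;>
    rcases key e₃ (by ring) with h3 | h3 | h3 <;>
    first
      | exact ⟨h1, h2, h3⟩
      | (exfalso; linarith)

variable {l : ℝ}

lemma rectangular_of_invariants (hl₀ : 0 < l) (hl₁ : l < 1) {a b : ℝ} {ha : 0 < a} {hb : 0 < b}
    (h2 : (rectangular a b ha hb).g₂ = (l : ℂ) ^ 2 + 1 / 3)
    (h3 : (rectangular a b ha hb).g₃ = (l : ℂ) ^ 2 / 3 - 1 / 27) :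
    ℘[rectangular a b ha hb] (b * Complex.I) = -1 / 3 ∧
      Real.sqrt ((1 + l) / 2) * a = ellipticK ((1 - l) / (1 + l)) ∧
      Real.sqrt ((1 + l) / 2) * b = ellipticK (2 * l / (1 + l)) := by
  obtain ⟨e₁, e₂, e₃, h₁₂, h₂₃, hsum, hg2, hg3, hP, hKa, hKb⟩ := rectangular_roots a b ha hb
  rw [hg2] at h2
  rw [hg3] at h3
  obtain ⟨rfl, rfl, rfl⟩ := roots_of_invariants hl₀ hl₁ h₁₂ h₂₃ hsum
    (by rw [← Complex.ofReal_inj, h2]; push_cast; rfl)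
    (by rw [← Complex.ofReal_inj, h3]; push_cast; rfl)
  have hl : 1 + l ≠ 0 := by positivity
  have e13 : (1 + l) / 2 - 1 / 3 - -1 / 3 = (1 + l) / 2 := by ring
  rw [e13] at hKa hKb
  refine ⟨by rw [hP]; norm_num, ?_, ?_⟩
  · rw [hKa]; congr 1; field_simp; ring
  · rw [hKb]; congr 1; field_simp; ring

lemma exists_rectangular_of_invariants (hl₀ : 0 < l) (hl₁ : l < 1) :
    ∃ (a b : ℝ) (ha : 0 < a) (hb : 0 < b),
      (rectangular a b ha hb).g₂ = (l : ℂ) ^ 2 + 1 / 3 ∧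
      (rectangular a b ha hb).g₃ = (l : ℂ) ^ 2 / 3 - 1 / 27 := by
  have hl : 0 < 1 + l := by positivity
  have hm1 : (1 - l) / (1 + l) < 1 := by rw [div_lt_one hl]; linarith
  have hn1 : 2 * l / (1 + l) < 1 := by rw [div_lt_one hl]; linarith
  have hmn : 2 * l / (1 + l) = 1 - (1 - l) / (1 + l) := by field_simp; ring
  have hs : 0 < Real.sqrt ((1 + l) / 2) := Real.sqrt_pos.2 (by positivity)
  have hs2 : Real.sqrt ((1 + l) / 2) ^ 2 = (1 + l) / 2 := Real.sq_sqrt (by positivity)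
  have hK := ellipticK_pos hm1
  have hK' := ellipticK_pos hn1
  set s := Real.sqrt ((1 + l) / 2)
  set m := (1 - l) / (1 + l) with hm
  have ha : 0 < ellipticK m / s := by positivity
  have hb : 0 < ellipticK (2 * l / (1 + l)) / s := by positivity
  refine ⟨_, _, ha, hb, ?_⟩
  obtain ⟨e₁, e₂, e₃, h₁₂, h₂₃, hsum, hg2, hg3, -, hKa, hKb⟩ := rectangular_roots _ _ ha hb
  have hD : 0 < e₁ - e₃ := by linarith
  have hD2 : Real.sqrt (e₁ - e₃) ^ 2 = e₁ - e₃ := Real.sq_sqrt hD.le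
  have hD0 : 0 < Real.sqrt (e₁ - e₃) := Real.sqrt_pos.2 hD
  set D := Real.sqrt (e₁ - e₃)
  have hp1 : (e₂ - e₃) / (e₁ - e₃) < 1 := by rw [div_lt_one hD]; linarith
  have hq1 : (e₁ - e₂) / (e₁ - e₃) < 1 := by rw [div_lt_one hD]; linarith
  have hpq : (e₁ - e₂) / (e₁ - e₃) = 1 - (e₂ - e₃) / (e₁ - e₃) := by field_simp; ring
  have hKa' : D * ellipticK m = s * ellipticK ((e₂ - e₃) / (e₁ - e₃)) := by
    rw [← hKa]; field_simp
  have hKb' : D * ellipticK (2 * l / (1 + l)) = s * ellipticK ((e₁ - e₂) / (e₁ - e₃)) := by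
    rw [← hKb]; field_simp
  rcases lt_trichotomy ((e₂ - e₃) / (e₁ - e₃)) m with h | h | h
  -- With $p=\frac{e_2-e_3}{e_1-e_3}$ one has $D\,K(m)=s\,K(p)$ and $D\,K(1-m)=s\,K(1-p)$. If $p<m$,
  -- the first gives $D<s$ and the second $D>s$.
  · exfalso
    have i1 := ellipticK_lt_ellipticK h hm1
    have i2 := ellipticK_lt_ellipticK
      (show 2 * l / (1 + l) < (e₁ - e₂) / (e₁ - e₃) by rw [hmn, hpq]; linarith) hq1
    have : D < s := by
      by_contra! hle
      nlinarith
    nlinarith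
  · have hDs : D = s := by
      rw [h] at hKa'
      exact mul_right_cancel₀ hK.ne' hKa'
    have e13 : e₁ - e₃ = (1 + l) / 2 := by rw [← hD2, hDs, hs2]
    have e23 : e₂ - e₃ = (1 - l) / 2 := by
      rw [div_eq_iff hD.ne', e13, hm] at h
      rw [h]
      field_simp
    have r3 : e₃ = -1 / 3 := by linarith
    have r2 : e₂ = (1 - l) / 2 - 1 / 3 := by linarith
    have r1 : e₁ = (1 + l) / 2 - 1 / 3 := by linarith
    rw [hg2, hg3, r1, r2, r3]
    push_cast
    constructor <;> ring
  · exfalso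
    have i1 := ellipticK_lt_ellipticK h hp1
    have i2 := ellipticK_lt_ellipticK
      (show (e₁ - e₂) / (e₁ - e₃) < 2 * l / (1 + l) by rw [hmn, hpq]; linarith) hn1
    have : s < D := by
      by_contra! hle
      nlinarith
    nlinarith

lemma rectangular_isFundamentalHalfPeriods {a b : ℝ} (ha : 0 < a) (hb : 0 < b) {f : ℂ → ℂ}
    (hf : ∀ c, Function.Periodic f c ↔ c ∈ (rectangular a b ha hb).lattice) :
    IsFundamentalHalfPeriods f a (b * Complex.I) := by
  refine ⟨(rectangular a b ha hb).indep, fun c ↦ ?_⟩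
  rw [hf, mem_lattice]
  simp only [rectangular, eq_comm]

end PeriodPair

/-! ### Identification of $d_\kappa$ and conclusion -/

open PeriodPair

lemma isNormalizedPair_iff {ω ω' : ℂ} : IsNormalizedPair ω ω' ↔
    ∃ a b : ℝ, 0 < a ∧ 0 < b ∧ ω = a ∧ ω' = b * Complex.I := by
  constructor
  · rintro ⟨⟨h1, h2⟩, h3, h4⟩
    simp only [neg_mul, Complex.neg_im, Complex.neg_re, Complex.mul_im, Complex.mul_re,
      Complex.I_re, Complex.I_im, zero_mul, one_mul, zero_add, zero_sub, neg_neg,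
      neg_eq_zero] at h3 h4
    exact ⟨ω.re, ω'.im, h2, h4, Complex.ext (by simp) (by simp [h1]),
      Complex.ext (by simp [h3]) (by simp)⟩
  · rintro ⟨a, b, ha, hb, rfl, rfl⟩
    simp [IsNormalizedPair, ha, hb]

lemma complementaryModulus_pos {κ : ℝ} (hκ₀ : 0 < κ) (hκ₁ : κ < 1) :
    0 < complementaryModulus κ := Real.sqrt_pos.2 (by nlinarith)

lemma complementaryModulus_lt_one {κ : ℝ} (hκ₀ : 0 < κ) : complementaryModulus κ < 1 := by
  rw [complementaryModulus, Real.sqrt_lt' one_pos]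
  nlinarith

/-- The difference of two solutions $y_1,y_2$ of the quadratic equation satisfies a linear one with
coefficient $2-3(y_1+y_2)$. The line $\mathbb R+\omega'$ avoids the lattice, and $\wp'(\omega')=0$
at the half-period. -/
lemma dnOfWeierstrass_ofReal {κ : ℝ} (hκ₀ : 0 < κ) (hκ₁ : κ < 1) {a b : ℝ} {ha : 0 < a}
    {hb : 0 < b}
    (h2 : (rectangular a b ha hb).g₂ = (complementaryModulus κ : ℂ) ^ 2 + 1 / 3)
    (hP : ℘[rectangular a b ha hb] (b * Complex.I) = -1 / 3) (u : ℝ) :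
    (rectangular a b ha hb).dnOfWeierstrass (b * Complex.I) u = shenD κ u := by
  set L := rectangular a b ha hb
  set w : ℂ := b * Complex.I with hw
  have hmem : ∀ t : ℝ, (t : ℂ) + w ∉ L.lattice := fun t ↦
    notMem_rectangular_of_im (by simpa [hw]) (by simpa [hw] using by linarith)
  have hP' : ℘'[L] w = 0 := L.derivWeierstrassP_eq_zero_of_two_mul_mem L.ω₂_mem_lattice
  have hPd : ∀ t : ℝ, HasDerivAt (fun t : ℝ ↦ ℘[L] (t + w)) (℘'[L] (t + w)) t := fun t ↦
    ((L.hasDerivAt_weierstrassP (hmem t)).comp_add_const (t : ℂ) w).comp_ofReal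
  have hPd' : ∀ t : ℝ, HasDerivAt (fun t : ℝ ↦ ℘'[L] (t + w))
      (6 * ℘[L] (t + w) ^ 2 - L.g₂ / 2) t := fun t ↦
    ((L.hasDerivAt_derivWeierstrassP (hmem t)).comp_add_const (t : ℂ) w).comp_ofReal
  have hd : ∀ t, HasDerivAt (shenD κ) (shenDDeriv κ t) t := fun t ↦
    (hasDerivAt_shenD_aux hκ₀ hκ₁ t).1
  have hPc : Continuous fun t : ℝ ↦ ℘[L] (t + w) :=
    continuous_iff_continuousAt.2 fun t ↦ (hPd t).continuousAt
  have hdc : Continuous (shenD κ) := continuous_iff_continuousAt.2 fun t ↦ (hd t).continuousAt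
  have key := eq_zero_of_linear_ode (h := fun t ↦ (shenD κ t : ℂ) - (1 / 3 - 2 * ℘[L] (t + w)))
    (h₁ := fun t ↦ (shenDDeriv κ t : ℂ) - -(2 * ℘'[L] (t + w)))
    (c := fun t ↦ 2 - 3 * ((shenD κ t : ℂ) + (1 / 3 - 2 * ℘[L] (t + w)))) (by fun_prop)
    (fun t ↦ (hd t).ofReal_comp.sub (((hPd t).const_mul 2).const_sub _))
    (fun t ↦ by
      convert! (hasDerivAt_shenD_aux hκ₀ hκ₁ t).2.ofReal_comp.sub ((hPd' t).const_mul 2).neg using 1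
      rw [h2]
      push_cast
      ring)
    (by
      simp only [shenD_zero hκ₀ hκ₁, Complex.ofReal_zero, zero_add, hP]
      norm_num)
    (by simp [shenDDeriv_zero hκ₀ hκ₁, hP']) u
  rw [L.dnOfWeierstrass_of_notMem (hmem u)]
  exact (sub_eq_zero.1 key).symm
end

open PeriodPair in
theorem mainTheorem2 (κ : ℝ) (hκ₀ : 0 < κ) (hκ₁ : κ < 1) :
    (∃ dn : ℂ → ℂ, IsShenDn κ dn) ∧
    (∃ (p : ℂ → ℂ) (ω ω' : ℂ),
      IsPKappa κ p ∧ IsNormalizedPair ω ω' ∧ IsFundamentalHalfPeriods p ω ω') ∧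
    ∀ (dn p : ℂ → ℂ) (ω ω' : ℂ),
      IsShenDn κ dn → IsPKappa κ p →
      IsNormalizedPair ω ω' → IsFundamentalHalfPeriods p ω ω' →
        IsFundamentalHalfPeriods dn ω ω' ∧
        (Real.sqrt ((1 + complementaryModulus κ) / 2) : ℂ) * ω =
          (Real.pi / 2 : ℂ) *
            (ordinaryHypergeometric (1 / 2 : ℝ) (1 / 2) 1
              ((1 - complementaryModulus κ) / (1 + complementaryModulus κ)) : ℝ) ∧
        (Real.sqrt ((1 + complementaryModulus κ) / 2) : ℂ) * ω' =
          Complex.I * (Real.pi / 2 : ℂ) *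
            (ordinaryHypergeometric (1 / 2 : ℝ) (1 / 2) 1
              (2 * complementaryModulus κ / (1 + complementaryModulus κ)) : ℝ) := by

  have hl₀ := complementaryModulus_pos hκ₀ hκ₁
  have hl₁ := complementaryModulus_lt_one hκ₀
  obtain ⟨a, b, ha, hb, hg2, hg3⟩ := exists_rectangular_of_invariants hl₀ hl₁
  refine ⟨⟨(rectangular a b ha hb).dnOfWeierstrass (b * Complex.I),
      meromorphicNFOn_dnOfWeierstrass _ _,
      dnOfWeierstrass_ofReal hκ₀ hκ₁ hg2 (rectangular_of_invariants hl₀ hl₁ hg2 hg3).1⟩,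
    ⟨℘[rectangular a b ha hb], a, b * Complex.I, ⟨_, hg2, hg3, rfl⟩,
      isNormalizedPair_iff.2 ⟨a, b, ha, hb, rfl, rfl⟩,
      rectangular_isFundamentalHalfPeriods ha hb fun c ↦ periodic_weierstrassP_iff _⟩, ?_⟩
  clear! a b
  rintro dn p ω ω' ⟨hdnNF, hdn⟩ ⟨L, hg2, hg3, rfl⟩ hnorm ⟨-, hper⟩
  obtain ⟨a, b, ha, hb, rfl, rfl⟩ := isNormalizedPair_iff.1 hnorm
  -- `L` may come with another basis, but its lattice is the period group of $\wp$, hence spanned by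
  -- the given rectangular pair.
  have hlat : L.lattice = (rectangular a b ha hb).lattice := by
    ext c
    rw [← L.periodic_weierstrassP_iff, hper, mem_lattice]
    simp only [rectangular, eq_comm]
  rw [g₂, G_congr hlat] at hg2
  rw [g₃, G_congr hlat] at hg3
  obtain ⟨hP, hKa, hKb⟩ := rectangular_of_invariants hl₀ hl₁ (ha := ha) (hb := hb) hg2 hg3
  have hdn' : dn = (rectangular a b ha hb).dnOfWeierstrass (b * Complex.I) :=
    eq_of_meromorphicNFOn_of_eq_ofReal hdnNF (meromorphicNFOn_dnOfWeierstrass _ _) fun u ↦ by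
      rw [hdn, dnOfWeierstrass_ofReal hκ₀ hκ₁ hg2 hP]
  set l := complementaryModulus κ
  have hl : 0 < 1 + l := by positivity
  rw [ellipticK_eq_hypergeometric (div_nonneg (by linarith) hl.le)
    (by rw [div_lt_one hl]; linarith)] at hKa
  rw [ellipticK_eq_hypergeometric (by positivity) (by rw [div_lt_one hl]; linarith)] at hKb
  refine ⟨?_, by exact_mod_cast hKa, ?_⟩
  · rw [hdn']
    exact rectangular_isFundamentalHalfPeriods ha hb fun c ↦ periodic_dnOfWeierstrass_iff _ _
  · rw [← mul_assoc, ← Complex.ofReal_mul, hKb]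
    push_cast
    ring
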